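/- For a metric space $(X,d)$ let $C_n^{\mathrm{uf}}(X;\mathbb{R})$ be the real vector space of functions $c\colon X^{n+1}\to\mathbb{R}$ such that $c$ is bounded; for every $r>0$ there is $K_r$ such that every ball of radius $r$ in $X^{n+1}$ (with the maximum metric) contains at most $K_r$ points of the support of $c$; and there is $R_c>0$ such that $d(x_i,x_j)\le R_c$ for all $i,j$ whenever $c(x_0,\dots,x_n)\neq 0$. With the boundary operator $\partial(x_0,\dots,x_n)=\sum_{j}(-1)^j(x_0,\dots,\widehat{x_j},\dots,x_n)$, extended to infinite sums, this is a chain complex; its homology is the uniformly finite homology $H_*^{\mathrm{uf}}(X;\mathbb{R})$. For a finitely generated group, $H_*^{\mathrm{uf}}$ is taken with respect to the word metric $d_S(g,h)=|g^{-1}h|_S$ of a finite generating set $S$; the statements below hold for every choice of $S$. A group $G$ is amenable if there is a left $G$-invariant mean on $\ell^\infty(G)$. (1) Let $G$ be a finitely generated infinite amenable group, let $l\ge 0$, and let $G\rtimes\mathbb{Z}^l$ be any semi-direct product (formed with any action of $\mathbb{Z}^l$ on $G$ by automorphisms). Then for all $k\in\{0,\dots,l\}$ $$\dim_{\mathbb{R}}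 H_k^{\mathrm{uf}}(G\rtimes\mathbb{Z}^l;\mathbb{R})=\infty .$$ More generally, let $A$ be a finitely generated amenable group acting on $G$ by automorphisms. Then $\dim_{\mathbb{R}} H_k^{\mathrm{uf}}(G\rtimes A;\mathbb{R})=\infty$ for every $k\ge 0$ for which the group homology $H_k(A;\mathbb{R})$ with trivial real coefficients is non-zero. (2) For all $l\ge 0$ and $k\ge 0$: $H_k^{\mathrm{uf}}(\mathbb{Z}^l;\mathbb{R})$ is infinite dimensional if $k<l$, is isomorphic to $\mathbb{R}$ if $k=l$, and is $0$ if $k>l$. -/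

import Mathlib

open scoped ENNReal

noncomputable section

/-! ### Uniformly finite homology of a metric space -/

section UniformlyFinite

/-- The push-forward of `c = ∑ c(x) · x` along the `j`-th face map
`(x_0, …, x_{n+1}) ↦ (x_0, …, x̂_j, …, x_{n+1})`: the coefficient at `y` is the sum of the
coefficients `c(x)` over all `x` obtained from `y` by inserting a point at position `j`
(a finite sum if `c` is a uniformly finite chain). -/
def ufFaceFun {X : Type*} {n : ℕ} (j : Fin (n + 2)) (c : (Fin (n + 2) → X) → ℝ) :
    (Fin (n + 1) → X) → ℝ :=
  fun y => ∑ᶠ z : X, c (j.insertNth z y)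

lemma exists_of_ufFaceFun_ne_zero {X : Type*} {n : ℕ} {j : Fin (n + 2)} {c : (Fin (n + 2) → X) → ℝ}
    {y : Fin (n + 1) → X} (h : ufFaceFun j c y ≠ 0) : ∃ z, c (j.insertNth z y) ≠ 0 := by
  by_contra! h0
  exact h (by simp [ufFaceFun, h0])

lemma insertNth_insertNth_of_le {X : Type*} {n : ℕ} {i j : Fin (n + 2)} (h : i ≤ j) (w z : X)
    (y : Fin (n + 1) → X) :
    (j.succ.insertNth w (i.insertNth z y : Fin (n + 2) → X) : Fin (n + 3) → X) =
      i.castSucc.insertNth z (j.insertNth w y : Fin (n + 2) → X) := by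
  have h1 : i.castSucc.succAbove j = j.succ :=
    Fin.succAbove_of_le_castSucc _ _ (by simpa using h)
  have h2 : j.succ.succAbove i = i.castSucc :=
    Fin.succAbove_of_castSucc_lt _ _ (Fin.castSucc_lt_succ_iff.2 h)
  have h3 : ∀ q, j.succ.succAbove (i.succAbove q) = i.castSucc.succAbove (j.succAbove q) := by
    intro q
    simp only [Fin.succAbove, Fin.lt_def, Fin.ext_iff, Fin.le_def] at *
    split_ifs <;> simp at * <;> omega
  refine Fin.insertNth_eq_iff.2 ⟨?_, Fin.insertNth_eq_iff.2 ⟨?_, ?_⟩⟩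
  · rw [← h1, Fin.insertNth_apply_succAbove, Fin.insertNth_apply_same]
  · rw [Fin.removeNth_apply, h2, Fin.insertNth_apply_same]
  · funext q
    rw [Fin.removeNth_apply, Fin.removeNth_apply, h3, Fin.insertNth_apply_succAbove,
      Fin.insertNth_apply_succAbove]

variable (X : Type*) [PseudoMetricSpace X]

/-- The real vector space `C_n^uf(X; ℝ)` of uniformly finite `n`-chains of `X`: the functions
`c : X^(n+1) → ℝ` which are bounded, whose support meets every ball of radius `r` of `X^(n+1)`
(with the maximum metric) in at most `K_r` points, and whose support consists of tuples of
uniformly bounded diameter. -/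
def ufChains (n : ℕ) : Submodule ℝ ((Fin (n + 1) → X) → ℝ) where
  carrier := {c |
    (∃ M : ℝ, ∀ x, |c x| ≤ M) ∧
    (∀ r : ℝ, 0 < r → ∃ K : ℕ, ∀ y, {x | x ∈ Metric.ball y r ∧ c x ≠ 0}.encard ≤ K) ∧
    (∃ R : ℝ, 0 < R ∧ ∀ x, c x ≠ 0 → ∀ i j, dist (x i) (x j) ≤ R)}
  zero_mem' := ⟨⟨0, by simp⟩, fun _ _ => ⟨0, by simp⟩, ⟨1, by simp⟩⟩
  add_mem' := by
    rintro a b ⟨⟨M, hM⟩, hK, ⟨R, hR, hR'⟩⟩ ⟨⟨M', hM'⟩, hK', ⟨R', hR2, hR2'⟩⟩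
    have hor : ∀ x, (a + b) x ≠ 0 → a x ≠ 0 ∨ b x ≠ 0 := by
      intro x hx
      by_contra! h
      exact hx (by simp [h.1, h.2])
    refine ⟨⟨M + M', fun x => (abs_add_le _ _).trans (add_le_add (hM x) (hM' x))⟩, ?_,
      ⟨max R R', lt_max_of_lt_left hR, fun x hx i j => ?_⟩⟩
    · intro r hr
      obtain ⟨K, hK⟩ := hK r hr
      obtain ⟨K', hK'⟩ := hK' r hr
      refine ⟨K + K', fun y => ?_⟩
      refine (Set.encard_le_encard (t := {x | x ∈ Metric.ball y r ∧ a x ≠ 0} ∪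
        {x | x ∈ Metric.ball y r ∧ b x ≠ 0}) ?_).trans ((Set.encard_union_le _ _).trans ?_)
      · rintro x ⟨hx, h⟩
        exact (hor x h).imp (fun h => ⟨hx, h⟩) (fun h => ⟨hx, h⟩)
      · push_cast
        exact add_le_add (hK y) (hK' y)
    · rcases hor x hx with h | h
      · exact (hR' x h i j).trans (le_max_left _ _)
      · exact (hR2' x h i j).trans (le_max_right _ _)
  smul_mem' := by
    rintro t a ⟨⟨M, hM⟩, hK, ⟨R, hR, hR'⟩⟩
    have hne : ∀ x, (t • a) x ≠ 0 → a x ≠ 0 := fun x hx h => hx (by simp [h])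
    refine ⟨⟨|t| * M, fun x => ?_⟩, ?_, ⟨R, hR, fun x hx => hR' x (hne x hx)⟩⟩
    · simp only [Pi.smul_apply, smul_eq_mul, abs_mul]
      exact mul_le_mul_of_nonneg_left (hM x) (abs_nonneg t)
    · intro r hr
      obtain ⟨K, hK⟩ := hK r hr
      refine ⟨K, fun y => le_trans (Set.encard_le_encard ?_) (hK y)⟩
      rintro x ⟨hx, hx'⟩
      exact ⟨hx, hne x hx'⟩

variable {X}

lemma ufChains_fiber {n : ℕ} {c : (Fin (n + 2) → X) → ℝ} (hc : c ∈ ufChains X (n + 1)) :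
    ∃ K : ℕ, ∀ (j : Fin (n + 2)) (y : Fin (n + 1) → X),
      {z : X | c (j.insertNth z y) ≠ 0}.encard ≤ K := by
  obtain ⟨-, hK, ⟨R, hR, hR'⟩⟩ := hc
  obtain ⟨K, hK⟩ := hK (R + 1) (by linarith)
  refine ⟨K, fun j y => ?_⟩
  refine le_trans ?_ (hK (j.insertNth (y 0) y))
  refine (Set.encard_le_encard_of_injOn (f := fun z => (j.insertNth z y : Fin (n + 2) → X)) ?_
    fun z _ z' _ h => (Fin.insertNth_inj.1 h).1)
  intro z hz
  refine ⟨?_, hz⟩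
  have h := hR' _ hz j (j.succAbove 0)
  rw [Fin.insertNth_apply_same, Fin.insertNth_apply_succAbove] at h
  rw [Metric.mem_ball, Fin.dist_insertNth_insertNth, dist_self]
  exact max_lt (by linarith) (by linarith)

lemma ufChains_fiber_finite {n : ℕ} {c : (Fin (n + 2) → X) → ℝ} (hc : c ∈ ufChains X (n + 1))
    (j : Fin (n + 2)) (y : Fin (n + 1) → X) :
    (Function.support fun z : X => c (j.insertNth z y)).Finite := by
  obtain ⟨K, hK⟩ := ufChains_fiber hc
  exact Set.finite_of_encard_le_coe (hK j y)

lemma ufFaceFun_mem {n : ℕ} (j : Fin (n + 2)) {c : (Fin (n + 2) → X) → ℝ}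
    (hc : c ∈ ufChains X (n + 1)) : ufFaceFun j c ∈ ufChains X n := by
  obtain ⟨K, hK⟩ := ufChains_fiber hc
  have hfin := ufChains_fiber_finite hc j
  obtain ⟨⟨M, hM⟩, hKr, ⟨R, hR, hR'⟩⟩ := hc
  refine ⟨⟨K * |M|, fun y => ?_⟩, fun r hr => ?_, ⟨R, hR, fun y hy a b => ?_⟩⟩
  · rw [ufFaceFun, finsum_eq_sum _ (hfin y)]
    refine (Finset.abs_sum_le_sum_abs _ _).trans ?_
    refine (Finset.sum_le_card_nsmul _ _ |M| fun z _ => (hM _).trans (le_abs_self M)).trans ?_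
    rw [nsmul_eq_mul]
    refine mul_le_mul_of_nonneg_right ?_ (abs_nonneg M)
    have := hK j y
    have h2 : {z : X | c (j.insertNth z y) ≠ 0} = ((hfin y).toFinset : Set X) := by
      ext; simp
    rw [h2, Set.encard_coe_eq_coe_finsetCard] at this
    exact_mod_cast this
  · obtain ⟨K', hK'⟩ := hKr (R + r + 1) (by linarith)
    refine ⟨K', fun y => ?_⟩
    refine le_trans ?_ (hK' (j.insertNth (y 0) y))
    have : Nonempty X := ⟨y 0⟩
    choose! f hf using fun x => exists_of_ufFaceFun_ne_zero (j := j) (c := c) (y := x)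
    refine Set.encard_le_encard_of_injOn
      (f := fun x => (j.insertNth (f x) x : Fin (n + 2) → X)) ?_ ?_
    · rintro x ⟨hx, hx0⟩
      refine ⟨?_, hf x hx0⟩
      have h := hR' _ (hf x hx0) j (j.succAbove 0)
      rw [Fin.insertNth_apply_same, Fin.insertNth_apply_succAbove] at h
      rw [Metric.mem_ball] at hx
      have h1 := dist_le_pi_dist x y 0
      have h2 := dist_triangle (f x) (x 0) (y 0)
      rw [Metric.mem_ball, Fin.dist_insertNth_insertNth]
      exact max_lt (by linarith) (by linarith)
    · intro x _ x' _ h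
      exact (Fin.insertNth_inj.1 h).2
  · obtain ⟨z, hz⟩ := exists_of_ufFaceFun_ne_zero hy
    simpa using hR' _ hz (j.succAbove a) (j.succAbove b)

/-- The `j`-th face map `C_{n+1}^uf(X; ℝ) → C_n^uf(X; ℝ)`. -/
def ufFace {n : ℕ} (j : Fin (n + 2)) : ufChains X (n + 1) →ₗ[ℝ] ufChains X n where
  toFun c := ⟨ufFaceFun j c, ufFaceFun_mem j c.2⟩
  map_add' a b := by
    ext y
    exact finsum_add_distrib (ufChains_fiber_finite a.2 j y) (ufChains_fiber_finite b.2 j y)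
  map_smul' t a := by
    ext y
    exact (smul_finsum t fun z => (a : (Fin (n + 2) → X) → ℝ) (j.insertNth z y)).symm

lemma ufFace_apply {n : ℕ} (j : Fin (n + 2)) (c : ufChains X (n + 1)) (y : Fin (n + 1) → X) :
    (ufFace j c).1 y = ∑ᶠ z : X, c.1 (j.insertNth z y) := rfl

lemma ufFace_comp_ufFace {n : ℕ} {i j : Fin (n + 2)} (h : i ≤ j) (c : ufChains X (n + 2)) :
    ufFace i (ufFace j.succ c) = ufFace j (ufFace i.castSucc c) := by
  ext y
  simp only [ufFace_apply]
  have hfin : (Function.support fun p : X × X =>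
      c.1 (j.succ.insertNth p.2 (i.insertNth p.1 y : Fin (n + 2) → X))).Finite := by
    obtain ⟨-, hK, ⟨R, hR, hR'⟩⟩ := c.2
    obtain ⟨K, hK⟩ := hK (R + 1) (by linarith)
    refine Set.Finite.of_finite_image (f := fun p : X × X =>
      (j.succ.insertNth p.2 (i.insertNth p.1 y : Fin (n + 2) → X) : Fin (n + 3) → X)) ?_ ?_
    · refine (Set.finite_of_encard_le_coe
        (hK (j.succ.insertNth (y 0) (i.insertNth (y 0) y : Fin (n + 2) → X)))).subset ?_
      rintro _ ⟨p, hp, rfl⟩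
      refine ⟨?_, hp⟩
      have ha := hR' _ hp j.succ (j.succ.succAbove (i.succAbove 0))
      have hb := hR' _ hp (j.succ.succAbove i) (j.succ.succAbove (i.succAbove 0))
      simp only [Fin.insertNth_apply_same, Fin.insertNth_apply_succAbove] at ha hb
      rw [Metric.mem_ball, Fin.dist_insertNth_insertNth, Fin.dist_insertNth_insertNth, dist_self]
      exact max_lt (by linarith) (max_lt (by linarith) (by linarith))
    · rintro ⟨a, b⟩ _ ⟨a', b'⟩ _ hab
      have h1 := Fin.insertNth_inj.1 hab
      have h2 := Fin.insertNth_inj.1 h1.2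
      exact Prod.ext h2.1 h1.1
  have hfin' := hfin.preimage (f := Prod.swap) Prod.swap_injective.injOn
  rw [← finsum_curry (fun p : X × X =>
      c.1 (j.succ.insertNth p.2 (i.insertNth p.1 y : Fin (n + 2) → X))) hfin,
    ← finsum_comp_equiv (Equiv.prodComm X X)]
  refine (finsum_curry _ hfin').trans ?_
  refine finsum_congr fun a => finsum_congr fun b => ?_
  exact congrArg c.1 (insertNth_insertNth_of_le h a b y)

/-- The boundary operator `∂(x_0, …, x_{n+1}) = ∑_j (-1)^j (x_0, …, x̂_j, …, x_{n+1})`, extended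
to uniformly finite chains. -/
def ufBoundary (n : ℕ) : ufChains X (n + 1) →ₗ[ℝ] ufChains X n :=
  ∑ j : Fin (n + 2), (-1 : ℝ) ^ (j : ℕ) • ufFace j

lemma ufBoundary_comp_ufBoundary (n : ℕ) :
    (ufBoundary n : ufChains X (n + 1) →ₗ[ℝ] ufChains X n) ∘ₗ ufBoundary (n + 1) = 0 := by
  ext1 c
  simp only [ufBoundary, LinearMap.comp_apply, LinearMap.sum_apply, LinearMap.smul_apply, map_sum,
    map_smul, LinearMap.zero_apply, Finset.smul_sum, smul_smul]
  rw [Finset.sum_comm]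
  simp only [← Finset.sum_product']
  let P := Fin (n + 2) × Fin (n + 3)
  let S : Finset P := {ij : P | (ij.2 : ℕ) ≤ (ij.1 : ℕ)}
  rw [Finset.univ_product_univ, ← Finset.sum_add_sum_compl S, ← eq_neg_iff_add_eq_zero,
    ← Finset.sum_neg_distrib]
  let φ : ∀ ij : P, ij ∈ S → P := fun ij hij =>
    (Fin.castLT ij.2 (lt_of_le_of_lt (Finset.mem_filter.mp hij).right (Fin.is_lt ij.1)), ij.1.succ)
  apply Finset.sum_bij φ
  · intro ij hij
    simp_rw [S, φ, Finset.compl_filter, Finset.mem_filter_univ, Fin.val_succ,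
      Fin.val_castLT] at hij ⊢
    lia
  · rintro ⟨i, j⟩ hij ⟨i', j'⟩ hij' h
    rw [Prod.mk_inj]
    exact ⟨by simpa [φ] using! congr_arg Prod.snd h,
      by simpa [φ, Fin.castSucc_castLT] using! congr_arg Fin.castSucc (congr_arg Prod.fst h)⟩
  · rintro ⟨i', j'⟩ hij'
    simp_rw [S, Finset.compl_filter, Finset.mem_filter_univ, not_le] at hij'
    refine ⟨(j'.pred <| ?_, Fin.castSucc i'), ?_, ?_⟩
    · rintro rfl
      simp only [Fin.val_zero, not_lt_zero] at hij'
    · simpa [S] using! Nat.le_sub_one_of_lt hij'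
    · simp only [φ, Fin.castLT_castSucc, Fin.succ_pred]
  · rintro ⟨i, j⟩ hij
    have hle : (j : ℕ) ≤ i := by simpa [S] using! hij
    have hj : (j : ℕ) < n + 2 := lt_of_le_of_lt hle i.2
    have := ufFace_comp_ufFace (i := j.castLT hj) (j := i) (by simpa [Fin.le_def] using hle) c
    simp only [φ, Fin.castSucc_castLT] at this ⊢
    rw [this, ← neg_smul]
    congr 1
    simp only [Fin.val_succ, Fin.val_castLT, pow_succ]
    ring

variable (X)

/-- The chain complex `(C_*^uf(X; ℝ), ∂)`. -/
def ufComplex : ChainComplex (ModuleCat ℝ) ℕ :=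
  ChainComplex.of (fun n => ModuleCat.of ℝ (ufChains X n))
    (fun n => ModuleCat.ofHom (ufBoundary n)) fun n => by
      rw [← ModuleCat.ofHom_comp, ufBoundary_comp_ufBoundary]
      rfl

/-- The uniformly finite homology `H_n^uf(X; ℝ)`. -/
def ufHomology (n : ℕ) : ModuleCat ℝ := (ufComplex X).homology n

end UniformlyFinite

/-! ### Word metrics and uniformly finite homology of finitely generated groups -/

section WordMetric

variable {G : Type*} [Group G]

/-- The word length of `g` with respect to `S`: the minimal `n` such that `g = s₁ ⋯ sₙ` with
`s₁, …, sₙ ∈ S ∪ S⁻¹` (meaningful if `S` generates `G`). -/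
def wordLength (S : Set G) (g : G) : ℕ :=
  sInf {n | ∃ w : List G, w.length = n ∧ (∀ s ∈ w, s ∈ S ∨ s⁻¹ ∈ S) ∧ w.prod = g}

lemma exists_word {S : Set G} (hS : Subgroup.closure S = ⊤) (g : G) :
    ∃ w : List G, w.length = wordLength S g ∧ (∀ s ∈ w, s ∈ S ∨ s⁻¹ ∈ S) ∧ w.prod = g := by
  refine Nat.sInf_mem (s := {n | ∃ w : List G, w.length = n ∧ (∀ s ∈ w, s ∈ S ∨ s⁻¹ ∈ S) ∧
    w.prod = g}) ?_
  obtain ⟨w, hw, rfl⟩ := Submonoid.exists_list_of_mem_closure (s := S ∪ S⁻¹) (x := g) (by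
    rw [← Subgroup.closure_toSubmonoid, hS]
    trivial)
  exact ⟨_, w, rfl, hw, rfl⟩

lemma wordLength_le {S : Set G} {w : List G} (hw : ∀ s ∈ w, s ∈ S ∨ s⁻¹ ∈ S) :
    wordLength S w.prod ≤ w.length :=
  Nat.sInf_le ⟨w, rfl, hw, rfl⟩

lemma wordLength_inv_le {S : Set G} (hS : Subgroup.closure S = ⊤) (g : G) :
    wordLength S g⁻¹ ≤ wordLength S g := by
  obtain ⟨w, hw, hw', rfl⟩ := exists_word hS g
  rw [← hw, List.prod_inv_reverse]
  refine (wordLength_le ?_).trans (by simp)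
  intro s hs
  obtain ⟨t, ht, rfl⟩ := List.mem_map.1 (List.mem_reverse.1 hs)
  simpa using (hw' t ht).symm

/-- The word metric `d_S(g, h) = |g⁻¹ h|_S` on `G` with respect to a generating set `S`. -/
@[reducible]
def wordMetricSpace (S : Set G) (hS : Subgroup.closure S = ⊤) : MetricSpace G where
  dist g h := wordLength S (g⁻¹ * h)
  dist_self g := by
    have := wordLength_le (S := S) (w := []) (by simp)
    simpa using this
  dist_comm g h := by
    have h1 := wordLength_inv_le hS (g⁻¹ * h)
    have h2 := wordLength_inv_le hS (h⁻¹ * g)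
    simp only [mul_inv_rev, inv_inv] at h1 h2
    exact_mod_cast le_antisymm h2 h1
  dist_triangle a b c := by
    obtain ⟨w, hw, hw', hwp⟩ := exists_word hS (a⁻¹ * b)
    obtain ⟨v, hv, hv', hvp⟩ := exists_word hS (b⁻¹ * c)
    have := wordLength_le (S := S) (w := w ++ v) (by
      intro s hs
      rcases List.mem_append.1 hs with h | h
      exacts [hw' s h, hv' s h])
    rw [List.prod_append, hwp, hvp, List.length_append, hw, hv] at this
    have e : a⁻¹ * b * (b⁻¹ * c) = a⁻¹ * c := by group
    rw [e] at this
    exact_mod_cast this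
  eq_of_dist_eq_zero {g h} h0 := by
    obtain ⟨w, hw, -, hwp⟩ := exists_word hS (g⁻¹ * h)
    have h0' : wordLength S (g⁻¹ * h) = 0 := by exact_mod_cast h0
    rw [h0', List.length_eq_zero_iff] at hw
    rw [hw, List.prod_nil] at hwp
    exact (inv_mul_eq_one.1 hwp.symm)

/-- `H_n^uf(G; ℝ)` for a group `G` with finite generating set `S`: the uniformly finite homology
of `G` with the word metric `d_S`. -/
def ufGroupHomology (S : Finset G) (hS : Subgroup.closure (S : Set G) = ⊤) (n : ℕ) :
    ModuleCat ℝ :=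
  letI := wordMetricSpace (S : Set G) hS
  ufHomology G n

end WordMetric

/-! ### Amenable groups -/

section Amenable

variable (G : Type*) [Group G]

/-- Left translation `(g · φ)(x) = φ(g⁻¹ x)` on the space `ℓ^∞(G)` of bounded real functions. -/
def leftTranslate {G : Type*} [Group G] (g : G) (φ : lp (fun _ : G => ℝ) ∞) :
    lp (fun _ : G => ℝ) ∞ :=
  ⟨fun x => φ (g⁻¹ * x), memℓp_infty <| (memℓp_infty_iff.1 (lp.memℓp φ)).mono <| by
    rintro _ ⟨x, rfl⟩
    exact ⟨g⁻¹ * x, rfl⟩⟩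

/-- A group is amenable if there is a left invariant mean on `ℓ^∞(G)`: a linear functional which
is `1` on the constant function `1`, is nonnegative on nonnegative functions, and is invariant
under left translation. -/
def IsAmenableGroup : Prop :=
  ∃ m : lp (fun _ : G => ℝ) ∞ →ₗ[ℝ] ℝ,
    m 1 = 1 ∧
    (∀ φ : lp (fun _ : G => ℝ) ∞, (∀ x, 0 ≤ φ x) → 0 ≤ m φ) ∧
    (∀ (g : G) (φ : lp (fun _ : G => ℝ) ∞), m (leftTranslate g φ) = m φ)

end Amenable

/-- The ordinary group homology `H_n(A; ℝ)` with trivial real coefficients. Mathlib's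
`groupHomology` wants the coefficient ring in the universe of the group, hence the `ULift`. -/
def realGroupHomology (A : Type*) [Group A] (n : ℕ) : ModuleCat (ULift ℝ) :=
  groupHomology (Rep.trivial (ULift ℝ) A (ULift ℝ)) n

end

/-! Let H be a group with a left invariant metric whose balls are finite. Record a tuple in H by its
base point and its successive quotients. A diameter bound leaves finitely many possible tuples of
quotients, and for each of them the coefficient is a bounded function of the base point. So
uniformly finite chains are inhomogeneous chains with coefficients in ℓ^∞(H) under right translation
(`ufChainsEquiv`, `ufBoundary_ofBar`), and uniformly finite homology is H_*(H; ℓ^∞(H)).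

Infinite dimension: let H be G ⋊ A, or ℤ × ℤ^n with G = ℤ and A = ℤ^n. A real cycle a of A and a
bounded f invariant under right translation by A give a cycle f ⊗ a of H. A right invariant mean m
on H and a cocycle u of A give a functional on the homology of H with value m(f)u(a) on it. So it
suffices to find f_i and m_i with m_i(f_k) = δ_ik (`not_finiteDimensional_ufHomology`). They come
from infinitely many disjoint subsets of G, each containing left translates of all finite sets
(`exists_separated_means`). A pair (a, u) with u(a) ≠ 0 exists as soon as H_k(A; ℝ) ≠ 0; for ℤ^n it
is a k-torus and a product of coordinates.

Degrees at least l for Γ = ℤ^l: dimension shifting goes from V[Γ], which has no homology in positive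
degrees, to V, removing one factor ℤ at a time. It shows that H_k(Γ; V) = 0 for k > l and that
H_l(Γ; V) embeds into the invariants of V (`exists_invariant_detection`). The invariants of ℓ^∞(Γ)
are the constants, and an invariant mean shows that the class of the torus with constant coefficient
1 is not zero. -/

noncomputable section

/-! ### Bounded functions and the bar complex -/

section Bar

/-- The space of bounded real functions on `H`. -/
def boundedFun (H : Type*) : Submodule ℝ (H → ℝ) where
  carrier := {f | ∃ M : ℝ, ∀ x, |f x| ≤ M}
  zero_mem' := ⟨0, by simp⟩
  add_mem' := by
    rintro a b ⟨M, hM⟩ ⟨N, hN⟩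
    exact ⟨M + N, fun x => (abs_add_le _ _).trans (add_le_add (hM x) (hN x))⟩
  smul_mem' := by
    rintro t a ⟨M, hM⟩
    refine ⟨|t| * M, fun x => ?_⟩
    simp only [Pi.smul_apply, smul_eq_mul, abs_mul]
    exact mul_le_mul_of_nonneg_left (hM x) (abs_nonneg t)

variable {H : Type*} [Group H]

variable (H) in
/-- The representation of `H` on bounded functions by right translations. -/
def rightTranslation : Representation ℝ H (boundedFun H) where
  toFun g :=
    { toFun := fun f => ⟨fun h => f.1 (h * g), f.2.imp fun _ hM x => hM _⟩
      map_add' := fun _ _ => rfl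
      map_smul' := fun _ _ => rfl }
  map_one' := by ext; simp
  map_mul' a b := by ext; simp [mul_assoc]

@[simp]
lemma rightTranslation_apply (g : H) (f : boundedFun H) (h : H) :
    (rightTranslation H g f).1 h = f.1 (h * g) := rfl

/-- The differential of the complex of inhomogeneous chains of a representation. -/
def barD {M : Type*} [AddCommGroup M] [Module ℝ M] (ρ : Representation ℝ H M) (n : ℕ) :
    ((Fin (n + 1) → H) →₀ M) →ₗ[ℝ] ((Fin n → H) →₀ M) :=
  Finsupp.lsum ℝ fun g => Finsupp.lsingle (fun i => g i.succ) ∘ₗ ρ (g 0)⁻¹ +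
    Finset.univ.sum fun j : Fin (n + 1) =>
      (-1 : ℝ) ^ ((j : ℕ) + 1) • Finsupp.lsingle (Fin.contractNth j (· * ·) g)

lemma barD_single {M : Type*} [AddCommGroup M] [Module ℝ M] (ρ : Representation ℝ H M) (n : ℕ)
    (g : Fin (n + 1) → H) (a : M) :
    barD ρ n (Finsupp.single g a) = Finsupp.single (fun i => g i.succ) (ρ (g 0)⁻¹ a) +
      Finset.univ.sum fun j : Fin (n + 1) =>
        (-1 : ℝ) ^ ((j : ℕ) + 1) • Finsupp.single (Fin.contractNth j (· * ·) g) a := by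
  simp [barD]

end Bar

/-! ### Uniformly finite chains as inhomogeneous chains -/

section Comparison

/-- A left invariant metric all of whose balls are finite. -/
structure IsInvariantProper (H : Type*) [Group H] [PseudoMetricSpace H] : Prop where
  dist_mul_left : ∀ g x y : H, dist (g * x) (g * y) = dist x y
  finite_ball : ∀ r : ℝ, {x : H | dist 1 x ≤ r}.Finite

lemma isInvariantProper_wordMetric {H : Type*} [Group H] (S : Finset H)
    (hS : Subgroup.closure (S : Set H) = ⊤) :
    @IsInvariantProper H _ (wordMetricSpace (S : Set H) hS).toPseudoMetricSpace := by
  let := wordMetricSpace (S : Set H) hS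
  refine ⟨fun g x y => ?_, fun r => ?_⟩
  · change ((wordLength _ _ : ℕ) : ℝ) = (wordLength _ _ : ℕ)
    congr 2
    group
  · classical
    let T : Set H := (S : Set H) ∪ (S : Set H)⁻¹
    have hT : T.Finite := S.finite_toSet.union S.finite_toSet.inv
    have hfin : ∀ n : ℕ, {w : List H | w.length = n ∧ ∀ s ∈ w, s ∈ T}.Finite := by
      intro n
      have := hT.to_subtype
      refine ((List.finite_length_eq T n).image (List.map Subtype.val)).subset ?_
      rintro w ⟨hw, hw'⟩
      lift w to List T using hw'
      exact ⟨w, by simpa using hw, rfl⟩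
    refine ((Set.finite_Iic ⌊r⌋₊).biUnion fun n _ => (hfin n).image List.prod).subset ?_
    intro x hx
    obtain ⟨w, hw, hw', hwp⟩ := exists_word hS x
    have hx' : ((wordLength (S : Set H) (1⁻¹ * x) : ℕ) : ℝ) ≤ r := hx
    rw [inv_one, one_mul] at hx'
    simp only [Set.mem_iUnion]
    exact ⟨_, Nat.le_floor hx', w, ⟨hw, fun s hs => hw' s hs⟩, hwp⟩

variable {H : Type*} [Group H] {n : ℕ}

/-- The successive quotients of a tuple. -/
def steps (x : Fin (n + 1) → H) : Fin n → H := fun i => (x i.castSucc)⁻¹ * x i.succ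

lemma steps_mul_partialProd (h : H) (g : Fin n → H) :
    steps (fun i => h * Fin.partialProd g i) = g := by
  funext i
  simp [steps, Fin.partialProd_succ, mul_assoc]

lemma mul_partialProd_steps (x : Fin (n + 1) → H) (i : Fin (n + 1)) :
    x 0 * Fin.partialProd (steps x) i = x i :=
  congrFun (Fin.partialProd_left_inv x) i

lemma steps_eq_iff {x : Fin (n + 1) → H} {g : Fin n → H} :
    steps x = g ↔ ∀ i, x i = x 0 * Fin.partialProd g i := by
  constructor
  · rintro rfl i
    exact (mul_partialProd_steps x i).symm
  · intro h
    rw [funext h]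
    exact steps_mul_partialProd _ _

open Classical in
-- Deleting a vertex other than the base point multiplies two adjacent quotients or drops the last
-- one. The deleted vertex is determined by the base point and `g`, so the sum over inserted points
-- has one term.
lemma ufFaceFun_succ_single (i : Fin (n + 1)) (g : Fin (n + 1) → H) (f : H → ℝ) :
    ufFaceFun i.succ (fun x => if steps x = g then f (x 0) else 0) =
      fun y => if steps y = Fin.contractNth i (· * ·) g then f (y 0) else 0 := by
  funext y
  have h0 : ∀ z, (i.succ.insertNth z y : Fin (n + 2) → H) 0 = y 0 := by
    intro z
    have : i.succ.succAbove 0 = 0 := by simp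
    conv_lhs => rw [← this, Fin.insertNth_apply_succAbove]
  have key : ∀ z, steps (i.succ.insertNth z y : Fin (n + 2) → H) = g ↔
      steps y = Fin.contractNth i (· * ·) g ∧ z = y 0 * Fin.partialProd g i.succ := by
    intro z
    rw [steps_eq_iff, steps_eq_iff, h0, Fin.partialProd_contractNth]
    rw [Fin.forall_iff_succAbove i.succ, Fin.insertNth_apply_same, and_comm]
    simp only [Fin.insertNth_apply_succAbove, Function.comp_apply]
  simp only [ufFaceFun, key, h0]
  rw [finsum_eq_single _ (y 0 * Fin.partialProd g i.succ)]
  · simp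
  · intro z hz
    simp [hz]

open Classical in
-- Deleting the base point moves it from y₀g₀⁻¹ to y₀. This is the source of the right translation
-- action on the coefficients.
lemma ufFaceFun_zero_single (g : Fin (n + 1) → H) (f : H → ℝ) :
    ufFaceFun 0 (fun x => if steps x = g then f (x 0) else 0) =
      fun y => if steps y = (fun i => g i.succ) then f (y 0 * (g 0)⁻¹) else 0 := by
  funext y
  have key : ∀ z, steps ((0 : Fin (n + 2)).insertNth z y : Fin (n + 2) → H) = g ↔
      steps y = (fun i => g i.succ) ∧ z = y 0 * (g 0)⁻¹ := by
    intro z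
    simp only [Fin.insertNth_zero']
    rw [funext_iff, Fin.forall_fin_succ, and_comm]
    have : ∀ i : Fin n, steps (Fin.cons z y : Fin (n + 2) → H) i.succ = steps y i := by
      intro i
      simp [steps]
    simp only [this, funext_iff]
    refine and_congr_right fun _ => ?_
    simp only [steps, Fin.castSucc_zero, Fin.cons_zero, Fin.cons_succ]
    rw [inv_mul_eq_iff_eq_mul, eq_mul_inv_iff_mul_eq, eq_comm]
  simp only [ufFaceFun, key]
  rw [finsum_eq_single _ (y 0 * (g 0)⁻¹)]
  · simp
  · intro z hz
    simp [hz]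

variable [PseudoMetricSpace H]

lemma IsInvariantProper.exists_card_ball (hH : IsInvariantProper H) (r : ℝ) :
    ∃ K : ℕ, ∀ y : H, {x | dist x y ≤ r}.encard ≤ K := by
  refine ⟨(hH.finite_ball r).toFinset.card, fun y => ?_⟩
  rw [← Set.encard_coe_eq_coe_finsetCard, Set.Finite.coe_toFinset]
  refine Set.encard_le_encard_of_injOn (f := fun x => y⁻¹ * x) (fun x hx => ?_)
    (fun a _ b _ h => by simpa using h)
  rw [Set.mem_ofPred_eq] at hx ⊢
  rwa [← hH.dist_mul_left y, mul_one, mul_inv_cancel_left, dist_comm]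

/-- A tuple is determined by its base point and its quotients. In the support the quotients range
over a finite set, so counts in balls reduce to counts of base points, and the diameter depends on
the quotients alone. -/
lemma mem_ufChains_of_finsupp (hH : IsInvariantProper H) (F : (Fin n → H) →₀ boundedFun H) :
    (fun x => (F (steps x)).1 (x 0)) ∈ ufChains H n := by
  classical
  have hne : ∀ x : Fin (n + 1) → H, (F (steps x)).1 (x 0) ≠ 0 → steps x ∈ F.support := by
    intro x hx
    rw [Finsupp.mem_support_iff]
    intro h
    exact hx (by simp [h])
  refine ⟨?_, fun r hr => ?_, ?_⟩
  · choose M hM using fun g => (F g).2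
    refine ⟨∑ g ∈ F.support, |M g|, fun x => ?_⟩
    by_cases hx : (F (steps x)).1 (x 0) = 0
    · beta_reduce
      rw [hx, abs_zero]
      exact Finset.sum_nonneg fun _ _ => abs_nonneg _
    · exact ((hM _ _).trans (le_abs_self _)).trans
        (Finset.single_le_sum (f := fun g => |M g|) (fun _ _ => abs_nonneg _) (hne x hx))
  · obtain ⟨K, hK⟩ := hH.exists_card_ball r
    refine ⟨K * F.support.card, fun y => ?_⟩
    have h1 : ((F.support : Set (Fin n → H))).encard = F.support.card :=
      Set.encard_coe_eq_coe_finsetCard _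
    have h2 : ({x : H | dist x (y 0) ≤ r} ×ˢ (F.support : Set (Fin n → H))).encard ≤
        ((K * F.support.card : ℕ) : ℕ∞) := by
      rw [Set.encard_prod, h1, Nat.cast_mul]
      gcongr
      exact hK _
    refine le_trans (Set.encard_le_encard_of_injOn (f := fun x => (x 0, steps x)) ?_ ?_) h2
    · rintro x ⟨hx, hx'⟩
      exact ⟨(dist_le_pi_dist x y 0).trans (Metric.mem_ball.1 hx).le, hne x hx'⟩
    · intro a _ b _ hab
      obtain ⟨h0, hs⟩ := Prod.mk.inj hab
      funext i
      rw [← mul_partialProd_steps a, ← mul_partialProd_steps b, h0, hs]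
  · refine ⟨1 + ∑ g ∈ F.support, ∑ i, ∑ j,
      dist (Fin.partialProd g i) (Fin.partialProd g j), by positivity, fun x hx i j => ?_⟩
    rw [← mul_partialProd_steps x i, ← mul_partialProd_steps x j, hH.dist_mul_left]
    have h1 := Finset.single_le_sum (f := fun g => ∑ i, ∑ j,
      dist (Fin.partialProd g i) (Fin.partialProd g j)) (fun _ _ => by positivity) (hne x hx)
    have h2 := Finset.single_le_sum (f := fun i => ∑ j,
      dist (Fin.partialProd (steps x) i) (Fin.partialProd (steps x) j))
      (fun _ _ => by positivity) (Finset.mem_univ i)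
    have h3 := Finset.single_le_sum (f := fun j =>
      dist (Fin.partialProd (steps x) i) (Fin.partialProd (steps x) j))
      (fun _ _ => by positivity) (Finset.mem_univ j)
    linarith

/-- The uniformly finite chain `∑ F(g)(h) · (h, h g₁, h g₁ g₂, …)` of a finitely supported
function `F` with bounded functions as values. -/
def ofBar (hH : IsInvariantProper H) (n : ℕ) :
    ((Fin n → H) →₀ boundedFun H) →ₗ[ℝ] ufChains H n where
  toFun F := ⟨fun x => (F (steps x)).1 (x 0), mem_ufChains_of_finsupp hH F⟩
  map_add' _ _ := rfl
  map_smul' _ _ := rfl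

lemma ofBar_apply (hH : IsInvariantProper H) (F : (Fin n → H) →₀ boundedFun H)
    (x : Fin (n + 1) → H) : (ofBar hH n F).1 x = (F (steps x)).1 (x 0) := rfl

lemma ofBar_injective (hH : IsInvariantProper H) : Function.Injective (ofBar hH n) := by
  intro F F' h
  ext g k
  have := congrFun (congrArg Subtype.val h) (fun i => k * Fin.partialProd g i)
  simpa [ofBar_apply, steps_mul_partialProd] using this

/-- The diameter bound puts every quotient of consecutive vertices into one ball around 1, which is
finite; this gives the finite support. -/
lemma ofBar_surjective (hH : IsInvariantProper H) : Function.Surjective (ofBar hH n) := by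
  rintro ⟨c, hc⟩
  obtain ⟨⟨M, hM⟩, -, ⟨R, hR, hR'⟩⟩ := id hc
  let Φ : (Fin n → H) → boundedFun H := fun g =>
    ⟨fun h => c fun i => h * Fin.partialProd g i, M, fun x => hM _⟩
  have hΦ : (Function.support Φ).Finite := by
    refine (Set.Finite.pi' fun _ : Fin n => hH.finite_ball R).subset fun g hg i => ?_
    have : ∃ h, (Φ g).1 h ≠ 0 := by
      by_contra! h
      exact hg (Subtype.ext (funext h))
    obtain ⟨h, hh⟩ := this
    have := hR' _ hh i.castSucc i.succ
    rw [hH.dist_mul_left, Fin.partialProd_succ] at this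
    rwa [Set.mem_ofPred_eq, ← hH.dist_mul_left (Fin.partialProd g i.castSucc), mul_one]
  refine ⟨Finsupp.ofSupportFinite Φ hΦ, ?_⟩
  ext x
  rw [ofBar_apply]
  change c _ = c _
  congr 1
  funext i
  exact mul_partialProd_steps x i

open Classical in
lemma ofBar_single (hH : IsInvariantProper H) (g : Fin n → H) (f : boundedFun H) :
    (ofBar hH n (Finsupp.single g f)).1 = fun x => if steps x = g then f.1 (x 0) else 0 := by
  funext x
  rw [ofBar_apply, Finsupp.single_apply]
  by_cases h : steps x = g
  · simp [h]
  · rw [if_neg h, if_neg (Ne.symm h)]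
    rfl

lemma ufBoundary_ofBar (hH : IsInvariantProper H) (F : (Fin (n + 1) → H) →₀ boundedFun H) :
    ufBoundary n (ofBar hH (n + 1) F) = ofBar hH n (barD (rightTranslation H) n F) := by
  classical
  induction F using Finsupp.induction_linear with
  | zero => simp
  | add F F' h h' => simp only [map_add, h, h']
  | single g f =>
    have h0 : ufFace 0 (ofBar hH (n + 1) (Finsupp.single g f)) =
        ofBar hH n (Finsupp.single (fun i => g i.succ) (rightTranslation H (g 0)⁻¹ f)) := by
      refine Subtype.ext ?_
      change ufFaceFun 0 (ofBar hH (n + 1) (Finsupp.single g f)).1 = _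
      rw [ofBar_single, ufFaceFun_zero_single, ofBar_single]
      rfl
    have h1 : ∀ i : Fin (n + 1), ufFace i.succ (ofBar hH (n + 1) (Finsupp.single g f)) =
        ofBar hH n (Finsupp.single (Fin.contractNth i (· * ·) g) f) := by
      intro i
      refine Subtype.ext ?_
      change ufFaceFun i.succ (ofBar hH (n + 1) (Finsupp.single g f)).1 = _
      rw [ofBar_single, ufFaceFun_succ_single, ofBar_single]
    rw [ufBoundary, Fin.sum_univ_succ]
    simp only [LinearMap.add_apply, LinearMap.sum_apply, LinearMap.smul_apply, h0, h1, barD_single,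
      map_add, map_sum, map_smul, Fin.val_zero, pow_zero, one_smul, Fin.val_succ]

/-- Uniformly finite chains are inhomogeneous chains with bounded functions as coefficients. -/
def ufChainsEquiv (hH : IsInvariantProper H) (n : ℕ) :
    ((Fin n → H) →₀ boundedFun H) ≃ₗ[ℝ] ufChains H n :=
  LinearEquiv.ofBijective (ofBar hH n) ⟨ofBar_injective hH, ofBar_surjective hH⟩

end Comparison

/-! ### Means -/

section Means

open Filter Topology

/-- A mean on the bounded functions: a positive functional which is `1` on the constant `1`. -/
structure IsMean {X : Type*} (m : boundedFun X →ₗ[ℝ] ℝ) : Prop where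
  const_one : ∀ f : boundedFun X, (∀ x, f.1 x = 1) → m f = 1
  nonneg : ∀ f : boundedFun X, (∀ x, 0 ≤ f.1 x) → 0 ≤ m f

lemma IsMean.const {X : Type*} {m : boundedFun X →ₗ[ℝ] ℝ} (hm : IsMean m) (c : ℝ)
    (f : boundedFun X) (hf : ∀ x, f.1 x = c) : m f = c := by
  let e : boundedFun X := ⟨fun _ => 1, 1, by simp⟩
  have : f = c • e := by
    ext x
    simp [hf, e]
  rw [this, map_smul, hm.const_one e fun _ => rfl]
  simp

lemma IsMean.abs_apply_le {X : Type*} {m : boundedFun X →ₗ[ℝ] ℝ} (hm : IsMean m) {c : ℝ}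
    {f : boundedFun X} (hf : ∀ x, |f.1 x| ≤ c) : |m f| ≤ c := by
  let e : boundedFun X := ⟨fun _ => c, |c|, by simp⟩
  have he : m e = c := hm.const c e fun _ => rfl
  have h1 := hm.nonneg (e - f) fun x => by
    have := (abs_le.1 (hf x)).2
    simpa [e] using this
  have h2 := hm.nonneg (e + f) fun x => by
    have := (abs_le.1 (hf x)).1
    simp only [e, Submodule.coe_add, Pi.add_apply]
    linarith
  rw [map_sub, he] at h1
  rw [map_add, he] at h2
  exact abs_le.2 ⟨by linarith, by linarith⟩

lemma exists_tendsto_ultrafilter {ι : Type*} (ω : Ultrafilter ι) (f : boundedFun ι) :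
    ∃ a, Tendsto f.1 ω (𝓝 a) := by
  obtain ⟨M, hM⟩ := f.2
  obtain ⟨a, -, ha⟩ := isCompact_Icc.ultrafilter_le_nhds' (ω.map f.1) (s := Set.Icc (-M) M)
    (Ultrafilter.mem_map.2 (Filter.univ_mem' fun x => abs_le.1 (hM x)))
  exact ⟨a, ha⟩

/-- The limit of bounded functions along an ultrafilter. -/
def ultraLim {ι : Type*} (ω : Ultrafilter ι) : boundedFun ι →ₗ[ℝ] ℝ where
  toFun f := (exists_tendsto_ultrafilter ω f).choose
  map_add' f g := tendsto_nhds_unique (exists_tendsto_ultrafilter ω (f + g)).choose_spec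
    ((exists_tendsto_ultrafilter ω f).choose_spec.add (exists_tendsto_ultrafilter ω g).choose_spec)
  map_smul' t f := tendsto_nhds_unique (exists_tendsto_ultrafilter ω (t • f)).choose_spec
    ((exists_tendsto_ultrafilter ω f).choose_spec.const_smul t)

lemma tendsto_ultraLim {ι : Type*} (ω : Ultrafilter ι) (f : boundedFun ι) :
    Tendsto f.1 ω (𝓝 (ultraLim ω f)) := (exists_tendsto_ultrafilter ω f).choose_spec

lemma ultraLim_eq {ι : Type*} {ω : Ultrafilter ι} {f : boundedFun ι} {a : ℝ}
    (h : Tendsto f.1 ω (𝓝 a)) : ultraLim ω f = a :=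
  tendsto_nhds_unique (tendsto_ultraLim ω f) h

lemma isMean_ultraLim {ι : Type*} (ω : Ultrafilter ι) : IsMean (ultraLim ω) where
  const_one f hf := ultraLim_eq (by simp [funext hf])
  nonneg f hf := ge_of_tendsto' (tendsto_ultraLim ω f) hf

/-- Means compose with families of means. -/
def meanBind {X Y : Type*} (m : boundedFun Y →ₗ[ℝ] ℝ)
    (μ : Y → boundedFun X →ₗ[ℝ] ℝ) (hμ : ∀ y, IsMean (μ y)) :
    boundedFun X →ₗ[ℝ] ℝ :=
  m ∘ₗ
    { toFun := fun f => ⟨fun y => μ y f, f.2.imp fun _ hM y => (hμ y).abs_apply_le hM⟩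
      map_add' := fun f g => by
        ext y
        exact map_add (μ y) f g
      map_smul' := fun t f => by
        ext y
        exact map_smul (μ y) t f }

lemma meanBind_apply {X Y : Type*} (m : boundedFun Y →ₗ[ℝ] ℝ)
    (μ : Y → boundedFun X →ₗ[ℝ] ℝ) (hμ : ∀ y, IsMean (μ y)) (f : boundedFun X) :
    meanBind m μ hμ f = m ⟨fun y => μ y f, f.2.imp fun _ hM y => (hμ y).abs_apply_le hM⟩ := rfl

lemma isMean_meanBind {X Y : Type*} {m : boundedFun Y →ₗ[ℝ] ℝ} (hm : IsMean m)
    (μ : Y → boundedFun X →ₗ[ℝ] ℝ) (hμ : ∀ y, IsMean (μ y)) : IsMean (meanBind m μ hμ) where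
  const_one f hf := hm.const_one _ fun y => (hμ y).const_one f hf
  nonneg f hf := hm.nonneg _ fun y => (hμ y).nonneg f hf

/-- Composition with a map, on bounded functions. -/
def boundedFun.comap {X Y : Type*} (p : X → Y) : boundedFun Y →ₗ[ℝ] boundedFun X where
  toFun f := ⟨fun x => f.1 (p x), f.2.imp fun _ hM x => hM (p x)⟩
  map_add' _ _ := rfl
  map_smul' _ _ := rfl

lemma IsMean.comp_comap {X Y : Type*} {m : boundedFun X →ₗ[ℝ] ℝ} (hm : IsMean m) (p : X → Y) :
    IsMean (m ∘ₗ boundedFun.comap p) where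
  const_one _ hf := hm.const_one _ fun x => hf (p x)
  nonneg _ hf := hm.nonneg _ fun x => hf (p x)

/-! ### Right invariant means on groups -/

/-- The existence of a right invariant mean. -/
def HasRightMean (H : Type*) [Group H] : Prop :=
  ∃ m : boundedFun H →ₗ[ℝ] ℝ, IsMean m ∧ ∀ h f, m (rightTranslation H h f) = m f

lemma IsAmenableGroup.hasRightMean {G : Type*} [Group G] (hG : IsAmenableGroup G) :
    HasRightMean G := by
  obtain ⟨m, h1, hpos, hinv⟩ := hG
  let T : boundedFun G →ₗ[ℝ] lp (fun _ : G => ℝ) ∞ :=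
    { toFun := fun f => ⟨fun x => f.1 x⁻¹, memℓp_infty <| by
        obtain ⟨M, hM⟩ := f.2
        refine ⟨M, ?_⟩
        rintro _ ⟨x, rfl⟩
        exact hM _⟩
      map_add' := fun _ _ => rfl
      map_smul' := fun _ _ => rfl }
  refine ⟨m ∘ₗ T, ⟨fun f hf => ?_, fun f hf => hpos _ fun x => hf _⟩, fun h f => ?_⟩
  · rw [← h1]
    refine congrArg m (lp.ext (funext fun x => ?_))
    exact hf _
  · refine Eq.trans (congrArg m (lp.ext (funext fun x => ?_))) (hinv h (T f))
    change f.1 (x⁻¹ * h) = f.1 (h⁻¹ * x)⁻¹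
    simp

/-- Average over G along each coset, then over A. Translation by `j y` is absorbed by the inner mean
after moving it past `ι a`, and translation by `ι b` by the outer one. -/
lemma HasRightMean.of_extension {G A H : Type*} [Group G] [Group A] [Group H] (j : G →* H)
    (ι : A →* H) (hnorm : ∀ (y : G) (a : A), ∃ y', ι a * j y = j y' * ι a)
    (hgen : ∀ h, ∃ y b, h = j y * ι b) (hG : HasRightMean G) (hA : HasRightMean A) :
    HasRightMean H := by
  obtain ⟨mG, hG1, hG2⟩ := hG
  obtain ⟨mA, hA1, hA2⟩ := hA
  let μ : A → boundedFun H →ₗ[ℝ] ℝ := fun a => mG ∘ₗ boundedFun.comap fun x => j x * ι a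
  have hμ : ∀ a, IsMean (μ a) := fun a => hG1.comp_comap _
  refine ⟨meanBind mA μ hμ, isMean_meanBind hA1 _ _, fun h f => ?_⟩
  have hj : ∀ (y : G) (f : boundedFun H) (a : A), μ a (rightTranslation H (j y) f) = μ a f := by
    intro y f a
    obtain ⟨y', hy'⟩ := hnorm y a
    refine Eq.trans (congrArg mG ?_) (hG2 y' (boundedFun.comap (fun x => j x * ι a) f))
    ext x
    change f.1 (j x * ι a * j y) = f.1 (j (x * y') * ι a)
    rw [mul_assoc, hy', map_mul, mul_assoc]
  obtain ⟨y, b, rfl⟩ := hgen h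
  rw [map_mul, Module.End.mul_apply, meanBind_apply, meanBind_apply]
  simp only [hj]
  refine Eq.trans (congrArg mA ?_) (hA2 b _)
  ext a
  refine congrArg mG ?_
  ext x
  change f.1 (j x * ι a * ι b) = f.1 (j x * ι (a * b))
  rw [map_mul, mul_assoc]

lemma hasRightMean_of_unique (G : Type*) [Group G] [Subsingleton G] : HasRightMean G := by
  refine ⟨{ toFun := fun f => f.1 1, map_add' := fun _ _ => rfl, map_smul' := fun _ _ => rfl },
    ⟨fun f hf => hf 1, fun f hf => hf 1⟩, fun h f => ?_⟩
  change f.1 (1 * h) = f.1 1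
  rw [Subsingleton.elim (1 * h) 1]

/-- The mean is a limit of Cesàro averages along a nonprincipal ultrafilter. -/
lemma hasRightMean_int : HasRightMean (Multiplicative ℤ) := by
  let ω : Ultrafilter ℕ := hyperfilter ℕ
  have havg : ∀ (f : boundedFun (Multiplicative ℤ)) (M : ℝ), (∀ x, |f.1 x| ≤ M) → ∀ n : ℕ,
      |(∑ i ∈ Finset.range (n + 1), f.1 (Multiplicative.ofAdd (i : ℤ))) / (n + 1)| ≤ M := by
    intro f M hM n
    have hn : (0 : ℝ) < n + 1 := by positivity
    rw [abs_div, abs_of_pos hn, div_le_iff₀ hn]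
    refine (Finset.abs_sum_le_sum_abs _ _).trans ?_
    refine (Finset.sum_le_card_nsmul _ _ M fun i _ => hM _).trans ?_
    simp [mul_comm]
  let T : boundedFun (Multiplicative ℤ) →ₗ[ℝ] boundedFun ℕ :=
    { toFun := fun f => ⟨fun n =>
        (∑ i ∈ Finset.range (n + 1), f.1 (Multiplicative.ofAdd (i : ℤ))) / (n + 1),
        f.2.imp fun M hM n => havg f M hM n⟩
      map_add' := fun f g => by
        ext n
        simp [Finset.sum_add_distrib, add_div]
      map_smul' := fun t f => by
        ext n
        simp [← Finset.mul_sum, mul_div_assoc] }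
  have hm : IsMean (ultraLim ω ∘ₗ T) := by
    refine ⟨fun f hf => (isMean_ultraLim ω).const_one _ fun n => ?_,
      fun f hf => (isMean_ultraLim ω).nonneg _ fun n => ?_⟩
    · have hn : (n : ℝ) + 1 ≠ 0 := by positivity
      simp [T, hf, div_self hn]
    · exact div_nonneg (Finset.sum_nonneg fun _ _ => hf _) (by positivity)
  refine ⟨_, hm, fun h f => ?_⟩
  -- The translations that fix the mean form a subgroup, so only the generator has to be checked;
  -- for it the difference of averages telescopes to two terms over n + 1.
  let K : Subgroup (Multiplicative ℤ) :=
    { carrier := {h | ∀ f, (ultraLim ω ∘ₗ T) (rightTranslation _ h f) = (ultraLim ω ∘ₗ T) f}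
      one_mem' := fun f => by rw [map_one, Module.End.one_apply]
      mul_mem' := fun {a b} ha hb f => by
        rw [map_mul, Module.End.mul_apply, ha, hb]
      inv_mem' := fun {a} ha f => by
        rw [← ha, ← Module.End.mul_apply, ← map_mul, mul_inv_cancel, map_one,
          Module.End.one_apply] }
  have h1 : Multiplicative.ofAdd (1 : ℤ) ∈ K := by
    intro f
    obtain ⟨M, hM⟩ := f.2
    rw [← sub_eq_zero, ← map_sub]
    refine ultraLim_eq (Tendsto.mono_left ?_ (Nat.hyperfilter_le_atTop))
    have hlim : Tendsto (fun n : ℕ => 2 * M / ((n : ℝ) + 1)) atTop (𝓝 0) := by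
      simpa [div_eq_mul_inv] using (tendsto_one_div_add_atTop_nhds_zero_nat (𝕜 := ℝ)).const_mul (2 * M)
    refine squeeze_zero_norm (fun n => ?_) hlim
    have hn : (0 : ℝ) < n + 1 := by positivity
    have e : (T (rightTranslation _ (Multiplicative.ofAdd (1 : ℤ)) f - f)).1 n =
        (f.1 (Multiplicative.ofAdd ((n + 1 : ℕ) : ℤ)) - f.1 (Multiplicative.ofAdd ((0 : ℕ) : ℤ))) /
          (n + 1) := by
      rw [← Finset.sum_range_sub (fun i : ℕ => f.1 (Multiplicative.ofAdd (i : ℤ)))]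
      rfl
    rw [e, norm_div, Real.norm_eq_abs, Real.norm_eq_abs, abs_of_pos hn]
    gcongr
    refine (abs_sub _ _).trans ?_
    linarith [hM (Multiplicative.ofAdd ((n + 1 : ℕ) : ℤ)), hM (Multiplicative.ofAdd ((0 : ℕ) : ℤ))]
  have : h ∈ K := by
    have := K.zpow_mem h1 (Multiplicative.toAdd h)
    rwa [← ofAdd_zsmul, smul_eq_mul, mul_one] at this
  exact this f

/-- The splitting `ℤ^(l+1) = ℤ × ℤ^l`: inclusion of the first factor. -/
def intPowInl (l : ℕ) : Multiplicative ℤ →* Multiplicative (Fin (l + 1) → ℤ) :=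
  AddMonoidHom.toMultiplicative
    { toFun := fun x => Fin.cons x 0
      map_zero' := by
        ext i
        refine Fin.cases ?_ (fun _ => ?_) i <;> simp
      map_add' := fun x y => by
        ext i
        refine Fin.cases ?_ (fun _ => ?_) i <;> simp }

/-- The splitting `ℤ^(l+1) = ℤ × ℤ^l`: inclusion of the second factor. -/
def intPowInr (l : ℕ) : Multiplicative (Fin l → ℤ) →* Multiplicative (Fin (l + 1) → ℤ) :=
  AddMonoidHom.toMultiplicative
    { toFun := fun x => Fin.cons 0 x
      map_zero' := by
        ext i
        refine Fin.cases ?_ (fun _ => ?_) i <;> simp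
      map_add' := fun x y => by
        ext i
        refine Fin.cases ?_ (fun _ => ?_) i <;> simp }

/-- The splitting `ℤ^(l+1) = ℤ × ℤ^l`: projection to the second factor. -/
def intPowSnd (l : ℕ) : Multiplicative (Fin (l + 1) → ℤ) →* Multiplicative (Fin l → ℤ) :=
  AddMonoidHom.toMultiplicative
    { toFun := fun x => Fin.tail x
      map_zero' := rfl
      map_add' := fun _ _ => rfl }

lemma hasRightMean_intPow (l : ℕ) : HasRightMean (Multiplicative (Fin l → ℤ)) := by
  induction l with
  | zero => exact hasRightMean_of_unique _
  | succ l ih =>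
    refine HasRightMean.of_extension (intPowInl l) (intPowInr l) (fun y a => ⟨y, mul_comm _ _⟩)
      (fun h => ⟨Multiplicative.ofAdd (Multiplicative.toAdd h 0), intPowSnd l h, ?_⟩)
      hasRightMean_int ih
    refine Multiplicative.toAdd.injective (funext fun i => ?_)
    refine Fin.cases ?_ (fun _ => ?_) i
    · simp [intPowInl, intPowInr]
    · simp only [toAdd_mul, Pi.add_apply]
      simp [intPowInl, intPowInr]
      rfl

/-- Exhaust G by finite sets `B n`, choose greedily pairwise disjoint left translates of ever larger
ones, and distribute them over countably many families by the pairing function. -/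
lemma exists_disjoint_thick (G : Type*) [Group G] [Infinite G] [Countable G] :
    ∃ T : ℕ → Set G, Pairwise (Function.onFun Disjoint T) ∧
      ∀ i (E : Finset G), ∃ x, ∀ e ∈ E, x * e ∈ T i := by
  classical
  obtain ⟨enum, henum⟩ := exists_surjective_nat G
  let B : ℕ → Finset G := fun n => (Finset.range n).image enum
  have hBmono : Monotone B := fun a b h => Finset.image_mono _ (Finset.range_mono h)
  have hB : ∀ E : Finset G, ∃ N, E ⊆ B N := by
    intro E
    choose ν hν using henum
    refine ⟨E.sup ν + 1, fun e he => Finset.mem_image.2 ⟨ν e, Finset.mem_range.2 ?_, hν e⟩⟩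
    exact Nat.lt_succ_of_le (Finset.le_sup he)
  let tr : ℕ × G → Finset G := fun q => (B q.1).image (q.2 * ·)
  obtain ⟨s, hs⟩ := exists_seq_of_forall_finset_exists (fun _ : ℕ × G => True)
    (fun a b => a.1 < b.1 ∧ Disjoint (tr a) (tr b)) (by
      intro s _
      let N := s.sup Prod.fst + 1
      let U : Finset G := s.biUnion tr
      -- Avoiding all u e⁻¹ with u in the earlier translates and e in `B N` makes x · `B N` disjoint
      -- from them.
      obtain ⟨x, hx⟩ := Infinite.exists_notMem_finset
        (Finset.image₂ (fun u e => u * e⁻¹) U (B N))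
      refine ⟨(N, x), trivial, fun a ha => ⟨Nat.lt_succ_of_le (Finset.le_sup (f := Prod.fst) ha), ?_⟩⟩
      rw [Finset.disjoint_left]
      rintro u hu hu'
      obtain ⟨e, he, rfl⟩ := Finset.mem_image.1 hu'
      exact hx (Finset.mem_image₂.2 ⟨x * e, Finset.mem_biUnion.2 ⟨a, ha, hu⟩, e, he, by simp⟩))
  have hmono : StrictMono fun n => (s n).1 := fun a b h => (hs.2 a b h).1
  have hdisj : ∀ a b, a ≠ b → Disjoint (tr (s a)) (tr (s b)) := by
    intro a b hab
    rcases lt_or_gt_of_ne hab with h | h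
    exacts [(hs.2 _ _ h).2, (hs.2 _ _ h).2.symm]
  refine ⟨fun i => ⋃ n, (tr (s (Nat.pair n i)) : Set G), fun i i' hi => ?_, fun i E => ?_⟩
  · simp only [Function.onFun, Set.disjoint_iUnion_left, Set.disjoint_iUnion_right,
      Finset.disjoint_coe]
    intro n n'
    refine hdisj _ _ fun h => hi ?_
    exact (Nat.pair_eq_pair.1 h).2
  · obtain ⟨N, hN⟩ := hB E
    refine ⟨(s (Nat.pair N i)).2, fun e he => Set.mem_iUnion.2 ⟨N, ?_⟩⟩
    refine Finset.mem_coe.2 (Finset.mem_image_of_mem _ (hBmono ?_ (hN he)))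
    exact (Nat.left_le_pair N i).trans (hmono.le_apply)

/-- `f i` is the indicator of the preimage of a thick set `T i`. `m i` first replaces g by h ↦ lim_E
g(j(x_E)h), where x_E · E ⊆ `T i`, and then applies an invariant mean. Left multiplication commutes
with right translation, so `m i` is still invariant, but it now sees only `T i`. -/
lemma exists_separated_means {G A H : Type*} [Group G] [Infinite G] [Countable G] [Group A]
    [Group H] (hH : HasRightMean H) (j : G →* H) (ι : A →* H) (p : H → G)
    (hp : ∀ x h, p (j x * h) = x * p h) (hpι : ∀ h a, p (h * ι a) = p h) :
    ∃ (f : ℕ → boundedFun H) (m : ℕ → boundedFun H →ₗ[ℝ] ℝ),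
      (∀ i a, rightTranslation H (ι a) (f i) = f i) ∧
      (∀ i h f, m i (rightTranslation H h f) = m i f) ∧
      ∀ i k, m i (f k) = if i = k then 1 else 0 := by
  classical
  obtain ⟨T, hT, hthick⟩ := exists_disjoint_thick G
  obtain ⟨m, hm1, hm2⟩ := hH
  choose x hx using hthick
  let ω : Ultrafilter (Finset G) := Ultrafilter.of atTop
  let μ : ℕ → H → boundedFun H →ₗ[ℝ] ℝ := fun i h =>
    ultraLim ω ∘ₗ boundedFun.comap fun E => j (x i E) * h
  have hμ : ∀ i h, IsMean (μ i h) := fun i h => (isMean_ultraLim ω).comp_comap _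
  let f : ℕ → boundedFun H := fun i => ⟨fun h => if p h ∈ T i then 1 else 0, 1, fun h => by
    by_cases hh : p h ∈ T i <;> simp [hh]⟩
  refine ⟨f, fun i => meanBind m (μ i) (hμ i), fun i a => ?_, fun i h g => ?_, fun i k => ?_⟩
  · ext h
    simp [f, hpι]
  · refine Eq.trans (congrArg m ?_) (hm2 h _)
    ext h'
    refine congrArg (ultraLim ω) ?_
    ext E
    change g.1 (j (x i E) * h' * h) = g.1 (j (x i E) * (h' * h))
    rw [mul_assoc]
  · refine hm1.const _ _ fun h => ultraLim_eq ?_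
    -- The ultrafilter refines `atTop`, so eventually E contains `p h`, and then x_E · `p h` lies in
    -- `T i`.
    have : ∀ᶠ E : Finset G in ω, p h ∈ E :=
      Ultrafilter.of_le atTop ((eventually_ge_atTop {p h}).mono fun E hE => hE (by simp))
    refine tendsto_const_nhds.congr' (this.mono fun E hE => ?_)
    change _ = if p (j (x i E) * h) ∈ T k then (1 : ℝ) else 0
    rw [hp]
    have hmem := hx i E _ hE
    by_cases hik : i = k
    · subst hik
      simp [hmem]
    · rw [if_neg hik, if_neg]
      exact Set.disjoint_left.1 (hT hik) hmem

end Means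

/-! ### Homology classes of inhomogeneous cycles -/

section Classes

open CategoryTheory

lemma exists_homologyClass_shortComplex {R : Type*} [Ring R] (S : ShortComplex (ModuleCat R)) :
    ∃ cl : LinearMap.ker S.g.hom →ₗ[R] S.homology, Function.Surjective cl ∧
      ∀ z, cl z = 0 ↔ ∃ b, S.f.hom b = z.1 := by
  let e := S.moduleCatHomologyIso.toLinearEquiv.symm
  refine ⟨e.toLinearMap ∘ₗ S.moduleCatLeftHomologyData.π.hom,
    e.surjective.comp (Submodule.mkQ_surjective _), fun z => ?_⟩
  refine (LinearEquiv.map_eq_zero_iff e).trans ?_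
  refine (Submodule.Quotient.mk_eq_zero (LinearMap.range S.moduleCatToCycles)).trans ?_
  rw [LinearMap.mem_range]
  exact ⟨fun ⟨b, hb⟩ => ⟨b, congrArg Subtype.val hb⟩, fun ⟨b, hb⟩ => ⟨b, Subtype.ext hb⟩⟩

lemma exists_homologyClass {R : Type*} [Ring R] (K : ChainComplex (ModuleCat R) ℕ) {i k j : ℕ}
    (hi : (ComplexShape.down ℕ).prev k = i) (hj : (ComplexShape.down ℕ).next k = j) :
    ∃ cl : LinearMap.ker (K.d k j).hom →ₗ[R] K.homology k, Function.Surjective cl ∧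
      ∀ z, cl z = 0 ↔ ∃ b, (K.d i k).hom b = z.1 := by
  subst hi hj
  exact exists_homologyClass_shortComplex (K.sc k)

variable {H M : Type*} [Group H] [AddCommGroup M] [Module ℝ M]

/-- The inhomogeneous cycles of a representation. -/
def barCycles (ρ : Representation ℝ H M) : (k : ℕ) → Submodule ℝ ((Fin k → H) →₀ M)
  | 0 => ⊤
  | n + 1 => LinearMap.ker (barD ρ n)

/-- The identification `e` is only additive because `R` may be `ULift ℝ` instead of `ℝ`; the last
clause transfers scalars when they match. -/
lemma exists_class_of_equiv {R : Type*} [Ring R] (K : ChainComplex (ModuleCat R) ℕ)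
    (ρ : Representation ℝ H M)
    (e : ∀ n, ((Fin n → H) →₀ M) ≃+ K.X n)
    (he : ∀ n x, (K.d (n + 1) n).hom (e (n + 1) x) = e n (barD ρ n x)) (k : ℕ) :
    ∃ cl : barCycles ρ k →+ K.homology k, Function.Surjective cl ∧
      (∀ z, cl z = 0 ↔ z.1 ∈ LinearMap.range (barD ρ k)) ∧
      ∀ (r : R) (t : ℝ), (∀ x, e k (t • x) = r • e k x) → ∀ x, cl (t • x) = r • cl x := by
  -- In degree 0 there is no outgoing arrow and the differential vanishes by `shape`, in agreement
  -- with `barCycles` being everything there.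
  have hnext : ∃ j, (ComplexShape.down ℕ).next k = j ∧
      ∀ x : barCycles ρ k, (K.d k j).hom (e k x.1) = 0 := by
    cases k with
    | zero => exact ⟨_, rfl, fun x => by rw [K.shape _ _ (by simp)]; rfl⟩
    | succ n =>
      refine ⟨n, by simp, fun x => ?_⟩
      have hx : barD ρ n x.1 = 0 := x.2
      rw [he, hx, map_zero]
  obtain ⟨j, hj, hcyc⟩ := hnext
  have hsurj : ∀ y, (K.d k j).hom y = 0 → (e k).symm y ∈ barCycles ρ k := by
    intro y hy
    cases k with
    | zero => trivial
    | succ n =>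
      obtain rfl : j = n := by rw [← hj]; simp
      have := he j ((e (j + 1)).symm y)
      rw [AddEquiv.apply_symm_apply, hy] at this
      exact ((e j).map_eq_zero_iff.1 this.symm)
  obtain ⟨cl, hcl, hcl0⟩ := exists_homologyClass K (i := k + 1) (by simp) hj
  refine ⟨cl.toAddMonoidHom.comp
    { toFun := fun x => ⟨e k x.1, hcyc x⟩
      map_zero' := Subtype.ext (map_zero (e k))
      map_add' := fun x y => Subtype.ext (map_add (e k) x.1 y.1) }, fun y => ?_, fun z => ?_,
      fun r t h x => ?_⟩
  · obtain ⟨z, rfl⟩ := hcl y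
    refine ⟨⟨(e k).symm z.1, hsurj _ z.2⟩, congrArg cl (Subtype.ext ?_)⟩
    exact (e k).apply_symm_apply z.1
  · refine (hcl0 _).trans ⟨fun ⟨b, hb⟩ => ⟨(e (k + 1)).symm b, (e k).injective ?_⟩,
      fun ⟨b, hb⟩ => ⟨e (k + 1) b, ?_⟩⟩
    · rw [← he, AddEquiv.apply_symm_apply, hb]
      rfl
    · rw [he, hb]
      rfl
  · refine Eq.trans (congrArg cl (Subtype.ext ?_)) (cl.map_smul r _)
    exact h x.1

lemma exists_ufHomology_class [PseudoMetricSpace H] (hH : IsInvariantProper H) (k : ℕ) :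
    ∃ cl : barCycles (rightTranslation H) k →ₗ[ℝ] ufHomology H k, Function.Surjective cl ∧
      ∀ z, cl z = 0 ↔ z.1 ∈ LinearMap.range (barD (rightTranslation H) k) := by
  obtain ⟨cl, h1, h2, h3⟩ := exists_class_of_equiv (ufComplex H) (rightTranslation H)
    (fun n => (ufChainsEquiv hH n).toAddEquiv) (fun n x => by
      have : (ufComplex H).d (n + 1) n = ModuleCat.ofHom (ufBoundary n) :=
        by simp [ufComplex]
      rw [this]
      exact ufBoundary_ofBar hH x) k
  exact ⟨{ cl with map_smul' := fun t x => h3 t t (map_smul (ufChainsEquiv hH k) t) x }, h1, h2⟩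

/-- The map on inhomogeneous chains induced by a homomorphism and a linear map of coefficients. -/
def barMap {A N : Type*} [Group A] [AddCommGroup N] [Module ℝ N] (φ : A →* H) (L : N →ₗ[ℝ] M)
    (n : ℕ) : ((Fin n → A) →₀ N) →ₗ[ℝ] ((Fin n → H) →₀ M) :=
  Finsupp.lsum ℝ fun g => Finsupp.lsingle (φ ∘ g) ∘ₗ L

lemma barMap_single {A N : Type*} [Group A] [AddCommGroup N] [Module ℝ N] (φ : A →* H)
    (L : N →ₗ[ℝ] M) (n : ℕ) (g : Fin n → A) (x : N) :
    barMap φ L n (Finsupp.single g x) = Finsupp.single (φ ∘ g) (L x) := by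
  simp [barMap]

lemma barD_barMap {A N : Type*} [Group A] [AddCommGroup N] [Module ℝ N] (φ : A →* H)
    (L : N →ₗ[ℝ] M) (σ : Representation ℝ A N) (ρ : Representation ℝ H M)
    (hL : ∀ a x, L (σ a x) = ρ (φ a) (L x)) (n : ℕ) (F : (Fin (n + 1) → A) →₀ N) :
    barD ρ n (barMap φ L (n + 1) F) = barMap φ L n (barD σ n F) := by
  induction F using Finsupp.induction_linear with
  | zero => simp
  | add F F' h h' => simp only [map_add, h, h']
  | single g x =>
    simp only [barMap_single, barD_single, map_add, map_sum, map_smul, hL, map_inv]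
    congr 1
    refine Finset.sum_congr rfl fun j _ => ?_
    congr 2
    exact (Fin.comp_contractNth (· * ·) (· * ·) (f := φ) (by simp) j g).symm

lemma barMap_mem_barCycles {A N : Type*} [Group A] [AddCommGroup N] [Module ℝ N] (φ : A →* H)
    (L : N →ₗ[ℝ] M) {σ : Representation ℝ A N} {ρ : Representation ℝ H M}
    (hL : ∀ a x, L (σ a x) = ρ (φ a) (L x)) {k : ℕ} {F : (Fin k → A) →₀ N}
    (hF : F ∈ barCycles σ k) : barMap φ L k F ∈ barCycles ρ k := by
  cases k with
  | zero => trivial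
  | succ n =>
    have hF' : barD σ n F = 0 := hF
    change barD ρ n _ = 0
    rw [barD_barMap φ L σ ρ hL, hF', map_zero]

/-- There are a cycle and a cocycle with real coefficients which pair non-trivially. -/
def HasPairing (A : Type*) [Group A] (k : ℕ) : Prop :=
  ∃ a ∈ barCycles (Representation.trivial ℝ A ℝ) k, ∃ u : ((Fin k → A) →₀ ℝ) →ₗ[ℝ] ℝ,
    (∀ b, u (barD (Representation.trivial ℝ A ℝ) k b) = 0) ∧ u a ≠ 0

variable {A : Type*} [Group A]

lemma barMap_comp_averaging (f : boundedFun H) (m : boundedFun H →ₗ[ℝ] ℝ) (ι : A →* H)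
    (π : H →* A) (hπ : ∀ a, π (ι a) = a) (k : ℕ) (a : (Fin k → A) →₀ ℝ) :
    barMap π m k (barMap ι (LinearMap.toSpanSingleton ℝ _ f) k a) = m f • a := by
  induction a using Finsupp.induction_linear with
  | zero => simp
  | add F F' h h' => simp only [map_add, h, h', smul_add]
  | single g x =>
    have : ⇑π ∘ ⇑ι ∘ g = g := funext fun i => hπ _
    rw [barMap_single, barMap_single, this]
    simp [mul_comm]

/-- An averaging functional on inhomogeneous chains with bounded coefficients vanishes on
boundaries. -/
lemma averaging_barD (m : boundedFun H →ₗ[ℝ] ℝ)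
    (hm : ∀ h f, m (rightTranslation H h f) = m f) (π : H →* A) {k : ℕ}
    {u : ((Fin k → A) →₀ ℝ) →ₗ[ℝ] ℝ}
    (hu : ∀ b, u (barD (Representation.trivial ℝ A ℝ) k b) = 0)
    (b : (Fin (k + 1) → H) →₀ boundedFun H) :
    u (barMap π m k (barD (rightTranslation H) k b)) = 0 := by
  rw [← barD_barMap π m (rightTranslation H) (Representation.trivial ℝ A ℝ) (fun h f => hm h f), hu]

theorem not_finiteDimensional_ufHomology [PseudoMetricSpace H] (hH : IsInvariantProper H)
    (ι : A →* H) (π : H →* A) (hπ : ∀ a, π (ι a) = a) (f : ℕ → boundedFun H)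
    (m : ℕ → boundedFun H →ₗ[ℝ] ℝ) (hf : ∀ i a, rightTranslation H (ι a) (f i) = f i)
    (hm : ∀ i h f, m i (rightTranslation H h f) = m i f)
    (hmf : ∀ i k, m i (f k) = if i = k then 1 else 0) {k : ℕ} (hA : HasPairing A k) :
    ¬ FiniteDimensional ℝ (ufHomology H k) := by
  obtain ⟨a, ha, u, hu, hua⟩ := hA
  obtain ⟨cl, -, hcl⟩ := exists_ufHomology_class hH k
  -- Since `f i` is fixed by A, the map t ↦ t · `f i` is equivariant along `ι`, so it sends cycles
  -- to cycles.
  have hz : ∀ i, barMap ι (LinearMap.toSpanSingleton ℝ _ (f i)) k a ∈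
      barCycles (rightTranslation H) k := fun i =>
    barMap_mem_barCycles ι _ (σ := Representation.trivial ℝ A ℝ) (fun b x => by simp [hf]) ha
  have hli : LinearIndependent ℝ fun i => cl ⟨_, hz i⟩ := by
    rw [linearIndependent_iff']
    intro s g hg i hi
    simp only [← map_smul, ← map_sum] at hg
    obtain ⟨b, hb⟩ := (hcl _).1 hg
    have h := averaging_barD (m i) (hm i) π hu b
    rw [hb] at h
    simp only [Submodule.coe_sum, Submodule.coe_smul, map_sum, map_smul,
      barMap_comp_averaging _ _ _ _ hπ, hmf, smul_eq_mul] at h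
    rw [Finset.sum_eq_single i (by
      intro j _ hj
      simp [Ne.symm hj]) (fun h' => absurd hi h')] at h
    simpa [hua] using h
  intro hfin
  exact not_finite_iff_infinite.2 inferInstance hli.finite_of_isNoetherian

end Classes

/-! ### Pairings of cycles and cocycles -/

section Pairing

open CategoryTheory

universe u in
-- Over a field, a cycle that is not a boundary is separated from the subspace of boundaries by a
-- linear functional.
lemma HasPairing.of_nontrivial {A : Type u} [Group A] {k : ℕ}
    (h : Nontrivial (realGroupHomology A k)) : HasPairing A k := by
  let V := Rep.trivial (ULift.{u} ℝ) A (ULift.{u} ℝ)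
  let e : ∀ n : ℕ, ((Fin n → A) →₀ ℝ) ≃+ ((Fin n → A) →₀ ULift.{u} ℝ) := fun n =>
    Finsupp.mapRange.addEquiv AddEquiv.ulift.symm
  have hes : ∀ n g x, e n (Finsupp.single g x) = Finsupp.single g (ULift.up x) := fun n g x => by
    simp only [e, Finsupp.mapRange.addEquiv_apply]
    exact Finsupp.mapRange_single
  have hsmul : ∀ n (r : ℝ) x, e n (r • x) = ULift.up.{u} r • e n x := fun n r x => by
    ext g
    simp [e]
    rfl
  obtain ⟨cl, hcl, hcl0, -⟩ := exists_class_of_equiv (groupHomology.inhomogeneousChains V)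
    (Representation.trivial ℝ A ℝ) e (fun n x => by
      rw [groupHomology.inhomogeneousChains.d_def]
      induction x using Finsupp.induction_linear with
      | zero => simp
      | add F F' h h' => simp only [map_add, h, h']
      | single g x =>
        rw [hes, barD_single]
        refine (groupHomology.inhomogeneousChains.d_single (A := V) n g (ULift.up x)).trans ?_
        rw [map_add, map_sum, hes]
        congr 1
        refine Finset.sum_congr rfl fun j _ => ?_
        rw [hsmul, hes]
        rfl) k
  obtain ⟨y, hy⟩ := exists_ne (0 : realGroupHomology A k)
  obtain ⟨z, rfl⟩ := hcl y
  obtain ⟨u, hu, hu'⟩ := Submodule.exists_le_ker_of_notMem fun hz => hy ((hcl0 z).2 hz)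
  exact ⟨z.1, z.2, u, fun b => hu' ⟨b, rfl⟩, hu⟩

/-! ### Tori and cup products -/

/-- The cup product of `k` real characters, as a functional on inhomogeneous chains. -/
def cupFunctional {A : Type*} [Group A] {k : ℕ} (χ : Fin k → A →* Multiplicative ℝ) :
    ((Fin k → A) →₀ ℝ) →ₗ[ℝ] ℝ :=
  Finsupp.lsum ℝ fun g => LinearMap.toSpanSingleton ℝ ℝ (∏ i, Multiplicative.toAdd (χ i (g i)))

lemma cupFunctional_single {A : Type*} [Group A] {k : ℕ} (χ : Fin k → A →* Multiplicative ℝ)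
    (g : Fin k → A) (x : ℝ) :
    cupFunctional χ (Finsupp.single g x) = x * ∏ i, Multiplicative.toAdd (χ i (g i)) := by
  simp [cupFunctional]

lemma prod_contractNth_castSucc {A : Type*} [Group A] {k : ℕ} (χ : Fin k → A →* Multiplicative ℝ)
    (g : Fin (k + 1) → A) (j : Fin k) :
    ∏ i, Multiplicative.toAdd (χ i (Fin.contractNth j.castSucc (· * ·) g i)) =
      (∏ i, Multiplicative.toAdd (χ i (g (j.castSucc.succAbove i)))) +
      ∏ i, Multiplicative.toAdd (χ i (g (j.succ.succAbove i))) := by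
  rw [← Finset.mul_prod_erase _ _ (Finset.mem_univ j), ← Finset.mul_prod_erase _ _ (Finset.mem_univ j),
    ← Finset.mul_prod_erase _ _ (Finset.mem_univ j)]
  have h1 : ∀ i ∈ Finset.univ.erase j, Fin.contractNth j.castSucc (· * ·) g i =
      g (j.castSucc.succAbove i) := by
    intro i hi
    rw [Fin.contractNth_apply_of_ne]
    exact fun h => (Finset.ne_of_mem_erase hi) (Fin.ext (by simpa using h.symm))
  have h2 : ∀ i ∈ Finset.univ.erase j, g (j.succ.succAbove i) = g (j.castSucc.succAbove i) := by
    intro i hi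
    congr 1
    have hne : (i : ℕ) ≠ j := fun h => (Finset.ne_of_mem_erase hi) (Fin.ext h)
    simp only [Fin.succAbove, Fin.lt_def, Fin.ext_iff]
    split_ifs <;> simp at * <;> omega
  have h3 : Fin.contractNth j.castSucc (· * ·) g j = g j.castSucc * g j.succ :=
    Fin.contractNth_apply_of_eq _ _ _ _ rfl
  have h1' : ∏ i ∈ Finset.univ.erase j,
      Multiplicative.toAdd (χ i (Fin.contractNth j.castSucc (· * ·) g i)) =
      ∏ i ∈ Finset.univ.erase j, Multiplicative.toAdd (χ i (g (j.castSucc.succAbove i))) :=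
    Finset.prod_congr rfl fun i hi => by rw [h1 i hi]
  have h2' : ∏ i ∈ Finset.univ.erase j, Multiplicative.toAdd (χ i (g (j.succ.succAbove i))) =
      ∏ i ∈ Finset.univ.erase j, Multiplicative.toAdd (χ i (g (j.castSucc.succAbove i))) :=
    Finset.prod_congr rfl fun i hi => by rw [h2 i hi]
  rw [h1', h2', h3]
  simp
  ring

lemma sum_neg_one_pow_telescope {k : ℕ} (W : Fin (k + 1) → ℝ) :
    W 0 + (∑ j : Fin k, (-1 : ℝ) ^ ((j : ℕ) + 1) * (W j.castSucc + W j.succ)) +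
      (-1) ^ (k + 1) * W (Fin.last k) = 0 := by
  induction k with
  | zero => simp
  | succ k ih =>
    have := ih fun i => W i.castSucc
    rw [Fin.sum_univ_castSucc]
    simp only [Fin.castSucc_zero, Fin.val_castSucc, Fin.val_last, Fin.succ_last,
      ← Fin.castSucc_succ] at this ⊢
    rw [pow_succ (-1 : ℝ) (k + 1)]
    linarith

lemma cupFunctional_barD {A : Type*} [Group A] {k : ℕ} (χ : Fin k → A →* Multiplicative ℝ)
    (b : (Fin (k + 1) → A) →₀ ℝ) :
    cupFunctional χ (barD (Representation.trivial ℝ A ℝ) k b) = 0 := by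
  induction b using Finsupp.induction_linear with
  | zero => simp
  | add F F' h h' => simp only [map_add, h, h', add_zero]
  | single g x =>
    -- `W j` omits the entry `j`. The outer faces give the two extreme values, and merging entries j
    -- and j + 1 gives `W j + W (j + 1)` because characters are additive; the alternating sum
    -- telescopes.
    let W : Fin (k + 1) → ℝ := fun j => ∏ i, Multiplicative.toAdd (χ i (g (j.succAbove i)))
    have h0 : ∏ i, Multiplicative.toAdd (χ i (g i.succ)) = W 0 := by simp [W]
    have h1 : ∏ i, Multiplicative.toAdd (χ i (Fin.contractNth (Fin.last k) (· * ·) g i)) =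
        W (Fin.last k) := by
      refine Finset.prod_congr rfl fun i _ => ?_
      rw [Fin.contractNth_apply_of_ne]
      simp [i.2.ne']
    rw [barD_single, map_add, map_sum, Fin.sum_univ_castSucc]
    simp only [map_smul, cupFunctional_single, prod_contractNth_castSucc, h0, h1, smul_eq_mul,
      Representation.trivial_apply, Fin.val_castSucc, Fin.val_last]
    have := sum_neg_one_pow_telescope W
    have h2 : ∀ j : Fin k, (-1 : ℝ) ^ ((j : ℕ) + 1) * (x * (W j.castSucc + W j.succ)) =
        x * ((-1 : ℝ) ^ ((j : ℕ) + 1) * (W j.castSucc + W j.succ)) := fun j => by ring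
    change x * W 0 + (∑ j : Fin k, (-1 : ℝ) ^ ((j : ℕ) + 1) * (x * (W j.castSucc + W j.succ)) + _) = 0
    rw [Finset.sum_congr rfl fun j _ => h2 j, ← Finset.mul_sum]
    linear_combination x * this

/-- The antisymmetrization of a tuple, as an inhomogeneous chain. -/
def torusChain {A : Type*} {k : ℕ} (e : Fin k → A) : (Fin k → A) →₀ ℝ :=
  ∑ σ : Equiv.Perm (Fin k), Finsupp.single (e ∘ σ) ((Equiv.Perm.sign σ : ℤ) : ℝ)

/-- Inner faces cancel in pairs under the transposition of the two merged entries, as the group is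
commutative. The two outer faces are matched by a cyclic rotation, whose sign (-1)^n against
(-1)^(n+1) leaves -1. -/
lemma torusChain_mem_barCycles {A : Type*} [CommGroup A] {k : ℕ} (e : Fin k → A) :
    torusChain e ∈ barCycles (Representation.trivial ℝ A ℝ) k := by
  cases k with
  | zero => trivial
  | succ n =>
    change barD _ n (torusChain e) = 0
    let s : Equiv.Perm (Fin (n + 1)) → ℝ := fun σ => ((Equiv.Perm.sign σ : ℤ) : ℝ)
    have hs : ∀ σ τ, s (σ * τ) = s σ * s τ := fun σ τ => by simp [s]
    have hmid : ∀ j : Fin n, ∑ σ : Equiv.Perm (Fin (n + 1)),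
        Finsupp.single (Fin.contractNth j.castSucc (· * ·) (e ∘ σ)) (s σ) = 0 := by
      intro j
      have hne : j.castSucc ≠ j.succ := (Fin.castSucc_lt_succ).ne
      have hx : ∀ σ : Equiv.Perm (Fin (n + 1)),
          Fin.contractNth j.castSucc (· * ·) (e ∘ (σ * Equiv.swap j.castSucc j.succ : Equiv.Perm (Fin (n + 1)))) =
          Fin.contractNth j.castSucc (· * ·) (e ∘ σ) := by
        intro σ
        funext i
        rcases lt_trichotomy (i : ℕ) (j.castSucc : ℕ) with h | h | h
        · rw [Fin.contractNth_apply_of_lt _ _ _ _ h, Fin.contractNth_apply_of_lt _ _ _ _ h]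
          simp only [Function.comp_apply, Equiv.Perm.mul_apply]
          rw [Equiv.swap_apply_of_ne_of_ne]
          · exact fun h' => by simp [Fin.ext_iff] at h' h; omega
          · exact fun h' => by simp [Fin.ext_iff] at h' h; omega
        · obtain rfl : i = j := Fin.ext h
          rw [Fin.contractNth_apply_of_eq _ _ _ _ h, Fin.contractNth_apply_of_eq _ _ _ _ h]
          simp [mul_comm]
        · rw [Fin.contractNth_apply_of_gt _ _ _ _ h, Fin.contractNth_apply_of_gt _ _ _ _ h]
          simp only [Function.comp_apply, Equiv.Perm.mul_apply]
          rw [Equiv.swap_apply_of_ne_of_ne]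
          · exact fun h' => by simp [Fin.ext_iff] at h' h; omega
          · exact fun h' => by simp [Fin.ext_iff] at h' h; omega
      have hsum := Equiv.sum_comp (Equiv.mulRight (Equiv.swap j.castSucc j.succ))
        fun σ : Equiv.Perm (Fin (n + 1)) =>
          Finsupp.single (Fin.contractNth j.castSucc (· * ·) (e ∘ σ)) (s σ)
      simp only [Equiv.coe_mulRight, hx, hs] at hsum
      have hsw : s (Equiv.swap j.castSucc j.succ) = -1 := by
        simp [s, Equiv.Perm.sign_swap hne]
      simp only [hsw, mul_neg, mul_one, Finsupp.single_neg, Finset.sum_neg_distrib] at hsum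
      exact self_eq_neg.1 hsum.symm
    have hlast : ∀ σ : Equiv.Perm (Fin (n + 1)),
        Fin.contractNth (Fin.last n) (· * ·) (e ∘ σ) = fun i => e (σ i.castSucc) := by
      intro σ
      funext i
      rw [Fin.contractNth_apply_of_lt _ _ _ _ (by simp)]
      rfl
    have hrot : ∑ σ : Equiv.Perm (Fin (n + 1)), Finsupp.single (fun i => e (σ i.castSucc)) (s σ) =
        (-1 : ℝ) ^ n • ∑ σ : Equiv.Perm (Fin (n + 1)),
          Finsupp.single (fun i : Fin n => e (σ i.succ)) (s σ) := by
      rw [← Equiv.sum_comp (Equiv.mulRight (finRotate (n + 1)))]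
      have hr : s (finRotate (n + 1)) = (-1) ^ n := by simp [s, sign_finRotate]
      simp only [Equiv.coe_mulRight, hs, hr, Equiv.Perm.mul_apply, Finset.smul_sum]
      refine Finset.sum_congr rfl fun σ _ => ?_
      rw [Finsupp.smul_single, smul_eq_mul, mul_comm]
      congr 1
      funext i
      simp
    simp only [torusChain, map_sum, barD_single, Finset.sum_add_distrib]
    rw [Finset.sum_comm (s := Finset.univ (α := Equiv.Perm (Fin (n + 1)))), Fin.sum_univ_castSucc]
    simp only [← Finset.smul_sum]
    have hmid' : ∑ j : Fin n, (-1 : ℝ) ^ ((j.castSucc : ℕ) + 1) • ∑ σ : Equiv.Perm (Fin (n + 1)),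
        Finsupp.single (Fin.contractNth j.castSucc (· * ·) (e ∘ σ)) (s σ) = 0 :=
      Finset.sum_eq_zero fun j _ => by rw [hmid j, smul_zero]
    refine (congrArg₂ (· + ·) rfl (congrArg₂ (· + ·) hmid' rfl)).trans ?_
    simp only [hlast, zero_add]
    refine (congrArg₂ (· + ·) rfl (congrArg _ hrot)).trans ?_
    rw [ smul_smul, Fin.val_last, ← pow_add]
    have : (-1 : ℝ) ^ (n + 1 + n) = -1 := Odd.neg_one_pow ⟨n, by ring⟩
    rw [this, neg_one_smul]
    exact add_neg_cancel _

/-- The torus of the first k basis vectors is paired with the dual coordinates; only the identity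
permutation contributes. -/
lemma hasPairing_intPow {l k : ℕ} (hk : k ≤ l) : HasPairing (Multiplicative (Fin l → ℤ)) k := by
  let e : Fin k → Multiplicative (Fin l → ℤ) := fun i =>
    Multiplicative.ofAdd (Pi.single (Fin.castLE hk i) 1)
  let χ : Fin k → Multiplicative (Fin l → ℤ) →* Multiplicative ℝ := fun i =>
    AddMonoidHom.toMultiplicative
      ((Int.castAddHom ℝ).comp (Pi.evalAddMonoidHom (fun _ : Fin l => ℤ) (Fin.castLE hk i)))
  have hχ : ∀ i j, Multiplicative.toAdd (χ i (e j)) = if i = j then 1 else 0 := by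
    intro i j
    simp [χ, e, Pi.single_apply, Fin.ext_iff]
  refine ⟨torusChain e, torusChain_mem_barCycles e, cupFunctional χ, cupFunctional_barD χ, ?_⟩
  simp only [torusChain, map_sum, cupFunctional_single, Function.comp_apply, hχ]
  rw [Finset.sum_eq_single 1]
  · simp
  · intro σ _ hσ
    obtain ⟨i, hi⟩ : ∃ i, i ≠ σ i := by
      by_contra! h
      exact hσ (Equiv.ext fun i => (h i).symm)
    rw [Finset.prod_eq_zero (Finset.mem_univ i) (if_neg hi), mul_zero]
  · simp

end Pairing

/-! ### Top-dimensional homology of free abelian groups -/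

section TopDegree

open CategoryTheory

lemma barD_barD {Γ V : Type} [Group Γ] [AddCommGroup V] [Module ℝ V] (ρ : Representation ℝ Γ V)
    (n : ℕ) (F : (Fin (n + 2) → Γ) →₀ V) : barD ρ n (barD ρ (n + 1) F) = 0 :=
  congrArg (fun φ => φ.hom F) (groupHomology.inhomogeneousChains.d_comp_d (A := Rep.of ρ) (n := n))

/-! ### Change of coefficients -/

section Coefficients

variable {Γ V W : Type*} [Group Γ] [AddCommGroup V] [Module ℝ V] [AddCommGroup W] [Module ℝ W]

variable (Γ) in
/-- The map on inhomogeneous chains induced by a linear map of coefficients. -/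
abbrev coeffMap (L : V →ₗ[ℝ] W) (n : ℕ) : ((Fin n → Γ) →₀ V) →ₗ[ℝ] ((Fin n → Γ) →₀ W) :=
  barMap (MonoidHom.id Γ) L n

lemma coeffMap_apply (L : V →ₗ[ℝ] W) (n : ℕ) (F : (Fin n → Γ) →₀ V) (g : Fin n → Γ) :
    coeffMap Γ L n F g = L (F g) := by
  classical
  induction F using Finsupp.induction_linear with
  | zero => simp
  | add F F' h h' => simp [h, h']
  | single g' x =>
    rw [barMap_single]
    change Finsupp.single g' (L x) g = _
    rw [Finsupp.single_apply, Finsupp.single_apply, apply_ite L, map_zero]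

lemma coeffMap_range {L : V →ₗ[ℝ] W} {n : ℕ} {F : (Fin n → Γ) →₀ W}
    (h : ∀ g, F g ∈ LinearMap.range L) : ∃ F', coeffMap Γ L n F' = F := by
  induction F using Finsupp.induction with
  | zero => exact ⟨0, map_zero _⟩
  | single_add g x F hg hx ih =>
    have hF : F g = 0 := Finsupp.notMem_support_iff.1 hg
    obtain ⟨F', hF'⟩ := ih fun g' => by
      by_cases hgg : g' = g
      · rw [hgg, hF]
        exact zero_mem _
      · simpa [Finsupp.single_apply, Ne.symm hgg] using h g'
    obtain ⟨y, hy⟩ : x ∈ LinearMap.range L := by simpa [hF] using h g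
    refine ⟨Finsupp.single g y + F', ?_⟩
    rw [map_add, hF', barMap_single, hy]
    rfl

lemma barD_coeffMap {L : V →ₗ[ℝ] W} {ρ : Representation ℝ Γ V} {σ : Representation ℝ Γ W}
    (hL : ∀ a x, L (ρ a x) = σ a (L x)) {n : ℕ} (F : (Fin (n + 1) → Γ) →₀ V) :
    barD σ n (coeffMap Γ L (n + 1) F) = coeffMap Γ L n (barD ρ n F) :=
  barD_barMap _ _ _ _ (by simpa using hL) _ _

lemma coeffMap_mem_barCycles {L : V →ₗ[ℝ] W} {ρ : Representation ℝ Γ V}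
    {σ : Representation ℝ Γ W} (hL : ∀ a x, L (ρ a x) = σ a (L x)) {n : ℕ}
    {F : (Fin n → Γ) →₀ V} (hF : F ∈ barCycles ρ n) : coeffMap Γ L n F ∈ barCycles σ n :=
  barMap_mem_barCycles _ _ (by simpa using hL) hF

end Coefficients

/-- Vanishing of the homology above degree `d`, and a detection of the homology in degree `d` by a
functional with values in `V` which is natural with respect to the endomorphisms `E ψ`. -/
structure IsTopDetected {Γ V N : Type} [Group Γ] [AddCommGroup V] [Module ℝ V] [AddCommGroup N]
    [Module ℝ N] (ρ : Representation ℝ Γ V) (σ : Representation ℝ Γ N)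
    (E : (V →ₗ[ℝ] V) → N →ₗ[ℝ] N) (d : ℕ) : Prop where
  vanish : ∀ k, d < k → ∀ z ∈ barCycles σ k, z ∈ LinearMap.range (barD σ k)
  detect : ∃ θ : ((Fin d → Γ) →₀ N) →ₗ[ℝ] V,
    (∀ z ∈ barCycles σ d, θ z = 0 → z ∈ LinearMap.range (barD σ d)) ∧
    (∀ b, θ (barD σ d b) = 0) ∧
    (∀ ψ : V →ₗ[ℝ] V, (∀ γ v, ψ (ρ γ v) = ρ γ (ψ v)) → ∀ z ∈ barCycles σ d,
      θ (coeffMap Γ (E ψ) d z) = ψ (θ z)) ∧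
    ∀ t, ∀ z ∈ barCycles σ d, θ (coeffMap Γ (σ t) d z) = θ z

/-- Dimension shifting along a short exact sequence `0 → N₁ → N₁ → N₃ → 0`. -/
lemma IsTopDetected.shift {Γ V N₁ N₃ : Type} [CommGroup Γ] [AddCommGroup V] [Module ℝ V]
    [AddCommGroup N₁] [Module ℝ N₁] [AddCommGroup N₃] [Module ℝ N₃] {ρ : Representation ℝ Γ V}
    {σ₁ : Representation ℝ Γ N₁} {σ₃ : Representation ℝ Γ N₃} {E₁ : (V →ₗ[ℝ] V) → N₁ →ₗ[ℝ] N₁}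
    {E₃ : (V →ₗ[ℝ] V) → N₃ →ₗ[ℝ] N₃} {d : ℕ} (h : IsTopDetected ρ σ₁ E₁ d)
    (f : N₁ →ₗ[ℝ] N₁) (g : N₁ →ₗ[ℝ] N₃) (s : N₃ →ₗ[ℝ] N₁) (hf : Function.Injective f)
    (hfg : ∀ x, g x = 0 ↔ x ∈ LinearMap.range f) (hgs : ∀ x, g (s x) = x)
    (hfσ : ∀ γ x, f (σ₁ γ x) = σ₁ γ (f x)) (hgσ : ∀ γ x, g (σ₁ γ x) = σ₃ γ (g x))
    (hEσ : ∀ ψ : V →ₗ[ℝ] V, (∀ γ v, ψ (ρ γ v) = ρ γ (ψ v)) →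
      ∀ γ x, E₁ ψ (σ₁ γ x) = σ₁ γ (E₁ ψ x))
    (hEf : ∀ ψ x, f (E₁ ψ x) = E₁ ψ (f x)) (hEs : ∀ ψ x, s (E₃ ψ x) = E₁ ψ (s x)) :
    IsTopDetected ρ σ₃ E₃ (d + 1) := by
  obtain ⟨hvan, θ, hθa, hθb, hθc, hθd⟩ := h
  have hexact : ∀ {n : ℕ} (F : (Fin n → Γ) →₀ N₁), coeffMap Γ g n F = 0 →
      ∃ w, coeffMap Γ f n w = F := fun F hF => coeffMap_range fun γ => (hfg _).1 (by
    rw [← coeffMap_apply, hF]; rfl)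
  have hfinj : ∀ n, Function.Injective (coeffMap Γ f n) := fun n F F' hFF => Finsupp.ext fun γ => by
    have := DFunLike.congr_fun hFF γ
    rw [coeffMap_apply, coeffMap_apply] at this
    exact hf this
  have hgsC : ∀ {n : ℕ} (F : (Fin n → Γ) →₀ N₃), coeffMap Γ g n (coeffMap Γ s n F) = F :=
    fun F => Finsupp.ext fun γ => by rw [coeffMap_apply, coeffMap_apply, hgs]
  have hgfC : ∀ {n : ℕ} (F : (Fin n → Γ) →₀ N₁), coeffMap Γ g n (coeffMap Γ f n F) = 0 :=
    fun F => Finsupp.ext fun γ => by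
      rw [coeffMap_apply, coeffMap_apply, (hfg _).2 ⟨_, rfl⟩]; rfl
  -- The connecting homomorphism: the boundary of the lift `s z` is killed by `g`, hence comes from
  -- a cycle `w` through `f`.
  have hlift : ∀ {n : ℕ} (z : (Fin (n + 1) → Γ) →₀ N₃), z ∈ barCycles σ₃ (n + 1) →
      ∃ w ∈ barCycles σ₁ n, coeffMap Γ f n w = barD σ₁ n (coeffMap Γ s (n + 1) z) := by
    intro n z hz
    obtain ⟨w, hw⟩ := hexact (barD σ₁ n (coeffMap Γ s (n + 1) z)) (by
      rw [← barD_coeffMap hgσ, hgsC]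
      exact hz)
    refine ⟨w, ?_, hw⟩
    cases n with
    | zero => trivial
    | succ m =>
      refine LinearMap.mem_ker.2 (hfinj _ ?_)
      rw [← barD_coeffMap hfσ, hw, barD_barD, map_zero]
  -- If w = ∂b, then s z − f b is a cycle above degree d, hence a boundary, and `g` maps it to z.
  have hbdry : ∀ {n : ℕ} (z : (Fin (n + 1) → Γ) →₀ N₃) (w : (Fin n → Γ) →₀ N₁), d < n + 1 →
      coeffMap Γ f n w = barD σ₁ n (coeffMap Γ s (n + 1) z) → w ∈ LinearMap.range (barD σ₁ n) →
      z ∈ LinearMap.range (barD σ₃ (n + 1)) := by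
    rintro n z w hn hw ⟨b, rfl⟩
    obtain ⟨c, hc⟩ := hvan (n + 1) hn (coeffMap Γ s (n + 1) z - coeffMap Γ f (n + 1) b) (by
      refine LinearMap.mem_ker.2 ?_
      rw [map_sub, barD_coeffMap hfσ, hw, sub_self])
    refine ⟨coeffMap Γ g (n + 2) c, ?_⟩
    rw [barD_coeffMap hgσ, hc, map_sub, hgsC, hgfC, sub_zero]
  -- A linear left inverse extends the connecting map to all chains, so that the new functional is θ
  -- ∘ p ∘ ∂ ∘ s.
  obtain ⟨p, hp⟩ := (coeffMap Γ f d).exists_leftInverse_of_injective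
    (LinearMap.ker_eq_bot.2 (hfinj d))
  have hp' : ∀ w, p (coeffMap Γ f d w) = w := fun w => LinearMap.congr_fun hp w
  refine ⟨fun k hk z hz => ?_, θ ∘ₗ p ∘ₗ barD σ₁ d ∘ₗ coeffMap Γ s (d + 1),
    fun z hz hz0 => ?_, fun b => ?_, fun ψ hψ z hz => ?_, fun t z hz => ?_⟩
  · obtain ⟨n, rfl⟩ : ∃ n, k = n + 1 := ⟨k - 1, by omega⟩
    obtain ⟨w, hw, hw'⟩ := hlift z hz
    exact hbdry z w (by omega) hw' (hvan n (by omega) w hw)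
  · obtain ⟨w, hw, hw'⟩ := hlift z hz
    refine hbdry z w (by omega) hw' (hθa w hw ?_)
    rw [LinearMap.comp_apply, LinearMap.comp_apply, LinearMap.comp_apply, ← hw', hp'] at hz0
    exact hz0
  -- The section `s` is not assumed equivariant; its failure to commute with ∂ is some `f c`, which
  -- contributes only the boundary of `c`, killed by θ. The last clause treats translation by t in
  -- the same way.
  · obtain ⟨c, hc⟩ := hexact (coeffMap Γ s (d + 1) (barD σ₃ (d + 1) b) -
      barD σ₁ (d + 1) (coeffMap Γ s (d + 2) b)) (by
        rw [map_sub, hgsC, ← barD_coeffMap hgσ, hgsC, sub_self])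
    have : coeffMap Γ s (d + 1) (barD σ₃ (d + 1) b) =
        barD σ₁ (d + 1) (coeffMap Γ s (d + 2) b) + coeffMap Γ f (d + 1) c := by
      rw [hc]; abel
    simp only [LinearMap.comp_apply]
    rw [this, map_add, barD_barD, zero_add, barD_coeffMap hfσ, hp', hθb]
  · obtain ⟨w, hw, hw'⟩ := hlift z hz
    have h1 : coeffMap Γ s (d + 1) (coeffMap Γ (E₃ ψ) (d + 1) z) =
        coeffMap Γ (E₁ ψ) (d + 1) (coeffMap Γ s (d + 1) z) := Finsupp.ext fun γ => by
      simp only [coeffMap_apply, hEs]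
    have h2 : coeffMap Γ (E₁ ψ) d (coeffMap Γ f d w) =
        coeffMap Γ f d (coeffMap Γ (E₁ ψ) d w) := Finsupp.ext fun γ => by
      simp only [coeffMap_apply, hEf]
    simp only [LinearMap.comp_apply]
    rw [h1, barD_coeffMap (hEσ ψ hψ), ← hw', h2, hp', hp', hθc ψ hψ w hw]
  · obtain ⟨w, hw, hw'⟩ := hlift z hz
    have hcomm : ∀ γ x, σ₁ t (σ₁ γ x) = σ₁ γ (σ₁ t x) := fun γ x => by
      rw [← Module.End.mul_apply, ← map_mul, mul_comm, map_mul, Module.End.mul_apply]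
    obtain ⟨c, hc⟩ := hexact (coeffMap Γ s (d + 1) (coeffMap Γ (σ₃ t) (d + 1) z) -
      coeffMap Γ (σ₁ t) (d + 1) (coeffMap Γ s (d + 1) z)) (Finsupp.ext fun γ => by
        simp only [map_sub, Finsupp.sub_apply, coeffMap_apply, hgσ, hgs, sub_self]
        rfl)
    have h1 : coeffMap Γ s (d + 1) (coeffMap Γ (σ₃ t) (d + 1) z) =
        coeffMap Γ (σ₁ t) (d + 1) (coeffMap Γ s (d + 1) z) + coeffMap Γ f (d + 1) c := by
      rw [hc]; abel
    have h2 : coeffMap Γ (σ₁ t) d (coeffMap Γ f d w) =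
        coeffMap Γ f d (coeffMap Γ (σ₁ t) d w) := Finsupp.ext fun γ => by
      simp only [coeffMap_apply, hfσ]
    simp only [LinearMap.comp_apply]
    rw [h1, map_add, barD_coeffMap hcomm, barD_coeffMap hfσ, ← hw', h2, map_add, hp', hp', hp',
      map_add, hθb, add_zero, hθd t w hw]

/-! ### Induced representations -/

section Induced

variable {Γ V Q : Type} [CommGroup Γ] [AddCommGroup V] [Module ℝ V]

section Action

variable [CommGroup Q]

/-- The diagonal action of `Γ` on finitely supported functions on a quotient group `Q` of `Γ`. -/
def indRep (r : Γ →* Q) (ρ : Representation ℝ Γ V) : Representation ℝ Γ (Q →₀ V) where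
  toFun γ := Finsupp.lsum ℝ fun q => Finsupp.lsingle (r γ * q) ∘ₗ ρ γ
  map_one' := by
    ext
    simp
  map_mul' a b := by
    ext
    simp [mul_assoc]

lemma indRep_single (r : Γ →* Q) (ρ : Representation ℝ Γ V) (γ : Γ) (q : Q) (v : V) :
    indRep r ρ γ (Finsupp.single q v) = Finsupp.single (r γ * q) (ρ γ v) := by
  simp [indRep]

/-- The contraction of the chains with coefficients in an induced representation. -/
def indContraction (e : Γ ≃* Q) (ρ : Representation ℝ Γ V) (n : ℕ) :
    ((Fin n → Γ) →₀ (Q →₀ V)) →ₗ[ℝ] ((Fin (n + 1) → Γ) →₀ (Q →₀ V)) :=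
  Finsupp.lsum ℝ fun g => Finsupp.lsum ℝ fun q =>
    Finsupp.lsingle (Fin.cons (e.symm q)⁻¹ g) ∘ₗ Finsupp.lsingle 1 ∘ₗ ρ (e.symm q)⁻¹

lemma indContraction_single (e : Γ ≃* Q) (ρ : Representation ℝ Γ V) (n : ℕ) (g : Fin n → Γ)
    (q : Q) (v : V) : indContraction e ρ n (Finsupp.single g (Finsupp.single q v)) =
      Finsupp.single (Fin.cons (e.symm q)⁻¹ g)
        (Finsupp.single 1 (ρ (e.symm q)⁻¹ v)) := by
  rw [indContraction, Finsupp.lsum_single, Finsupp.lsum_single]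
  rfl

lemma contractNth_zero_cons {α : Type*} [Mul α] {n : ℕ} (a : α) (g : Fin (n + 1) → α) :
    Fin.contractNth 0 (· * ·) (Fin.cons a g : Fin (n + 2) → α) =
      (Fin.cons (a * g 0) fun i => g i.succ) := by
  funext i
  refine Fin.cases ?_ (fun i => ?_) i
  · rw [Fin.contractNth_apply_of_eq _ _ _ _ (by simp)]
    simp
  · rw [Fin.contractNth_apply_of_gt _ _ _ _ (by simp)]
    simp

lemma contractNth_succ_cons {α : Type*} [Mul α] {n : ℕ} (j : Fin (n + 1)) (a : α)
    (g : Fin (n + 1) → α) :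
    Fin.contractNth j.succ (· * ·) (Fin.cons a g : Fin (n + 2) → α) =
      Fin.cons a (Fin.contractNth j (· * ·) g) := by
  funext i
  refine Fin.cases ?_ (fun i => ?_) i
  · rw [Fin.contractNth_apply_of_lt _ _ _ _ (by simp)]
    simp
  · simp only [Fin.cons_succ]
    rcases lt_trichotomy (i : ℕ) (j : ℕ) with h | h | h
    · rw [Fin.contractNth_apply_of_lt _ _ _ _ h, Fin.contractNth_apply_of_lt _ _ _ _ (by simpa)]
      simp
    · rw [Fin.contractNth_apply_of_eq _ _ _ _ h, Fin.contractNth_apply_of_eq _ _ _ _ (by simpa)]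
      simp
    · rw [Fin.contractNth_apply_of_gt _ _ _ _ h, Fin.contractNth_apply_of_gt _ _ _ _ (by simpa)]
      simp

/-- The new first entry is chosen so that the first face restores the given chain; all other faces
cancel against the contraction of the boundary. -/
lemma indContraction_spec (e : Γ ≃* Q) (ρ : Representation ℝ Γ V) (n : ℕ)
    (F : (Fin (n + 1) → Γ) →₀ (Q →₀ V)) :
    barD (indRep e.toMonoidHom ρ) (n + 1) (indContraction e ρ (n + 1) F) +
      indContraction e ρ n (barD (indRep e.toMonoidHom ρ) n F) = F := by
  induction F using Finsupp.induction_linear with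
  | zero => simp
  | add F F' h h' =>
    simp only [map_add]
    conv_rhs => rw [← h, ← h']
    abel
  | single g x =>
    induction x using Finsupp.induction_linear with
    | zero => simp
    | add F F' h h' =>
      simp only [map_add, Finsupp.single_add]
      conv_rhs => rw [← h, ← h']
      abel
    | single q v =>
      have h1 : ρ (e.symm q) (ρ (e.symm q)⁻¹ v) = v := by
        rw [← Module.End.mul_apply, ← map_mul, mul_inv_cancel, map_one, Module.End.one_apply]
      have h2 : ρ (e.symm (e (g 0)⁻¹ * q))⁻¹ (ρ (g 0)⁻¹ v) = ρ (e.symm q)⁻¹ v := by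
        rw [← Module.End.mul_apply, ← map_mul]
        simp
      have h3 : (e.symm (e (g 0)⁻¹ * q))⁻¹ = (e.symm q)⁻¹ * g 0 := by simp
      rw [indContraction_single, barD_single, barD_single, map_add, map_sum, Fin.sum_univ_succ]
      simp only [indRep_single, map_smul, indContraction_single, MulEquiv.toMonoidHom_eq_coe,
        MonoidHom.coe_coe, contractNth_zero_cons, contractNth_succ_cons, Fin.cons_zero,
        Fin.cons_succ, inv_inv, h1, h2, Fin.val_zero, zero_add, pow_one, Fin.val_succ]
      rw [h3]
      simp only [pow_succ (-1 : ℝ) (_ + 1), mul_neg, mul_one, neg_smul, Finset.sum_neg_distrib,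
        one_smul, MulEquiv.apply_symm_apply]
      abel

/-- The contraction kills positive degrees. In degree 0 the coinvariants of the diagonal action are
V, by q ⊗ v ↦ q⁻¹v. -/
lemma isTopDetected_indRep_equiv (e : Γ ≃* Q) (ρ : Representation ℝ Γ V) :
    IsTopDetected ρ (indRep e.toMonoidHom ρ) Finsupp.mapRange.linearMap 0 := by
  refine ⟨fun k hk z hz => ?_, ?_⟩
  · obtain ⟨n, rfl⟩ : ∃ n, k = n + 1 := ⟨k - 1, by omega⟩
    have := indContraction_spec e ρ n z
    have hz' : barD (indRep e.toMonoidHom ρ) n z = 0 := hz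
    rw [hz', map_zero, add_zero] at this
    exact ⟨_, this⟩
  · let α : (Q →₀ V) →ₗ[ℝ] V := Finsupp.lsum ℝ fun q => ρ (e.symm q)⁻¹
    have hα : ∀ q v, α (Finsupp.single q v) = ρ (e.symm q)⁻¹ v := fun q v => by simp [α]
    have hαt : ∀ t x, α (indRep e.toMonoidHom ρ t x) = α x := by
      intro t x
      induction x using Finsupp.induction_linear with
      | zero => simp
      | add x y hx hy => simp only [map_add, hx, hy]
      | single q v =>
        rw [indRep_single, hα, hα, ← Module.End.mul_apply, ← map_mul]
        simp
    let θ : ((Fin 0 → Γ) →₀ (Q →₀ V)) →ₗ[ℝ] V := α ∘ₗ Finsupp.lapply default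
    have hθ : ∀ g x, θ (Finsupp.single g x) = α x := fun g x => by
      simp [θ, Subsingleton.elim g default]
    have hred : ∀ z : (Fin 0 → Γ) →₀ (Q →₀ V), z - Finsupp.single default (Finsupp.single 1 (θ z)) ∈
        LinearMap.range (barD (indRep e.toMonoidHom ρ) 0) := by
      intro z
      induction z using Finsupp.induction_linear with
      | zero => simp
      | add F F' h h' =>
        have := add_mem h h'
        simp only [map_add, Finsupp.single_add]
        convert this using 1
        abel
      | single g x =>
        rw [hθ]
        induction x using Finsupp.induction_linear with
        | zero => simp
        | add F F' h h' =>
          have := add_mem h h'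
          simp only [map_add, Finsupp.single_add]
          convert this using 1
          abel
        | single q v =>
          refine ⟨-Finsupp.single (fun _ => e.symm q) (Finsupp.single q v), ?_⟩
          rw [map_neg, barD_single, indRep_single, hα, Fin.sum_univ_one]
          simp [Subsingleton.elim _ (default : Fin 0 → Γ), sub_eq_add_neg]
    refine ⟨θ, fun z _ hz => ?_, fun b => ?_, fun ψ hψ z _ => ?_, fun t z _ => ?_⟩
    · simpa [hz] using hred z
    · induction b using Finsupp.induction_linear with
      | zero => simp
      | add F F' h h' => simp only [map_add, h, h', add_zero]
      | single g x =>
        rw [barD_single, map_add, hθ, hαt, Fin.sum_univ_one, map_smul, hθ]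
        simp
    · change α (coeffMap Γ _ 0 z default) = ψ (α (z default))
      rw [coeffMap_apply]
      induction z default using Finsupp.induction_linear with
      | zero => simp
      | add x y hx hy => simp only [map_add, hx, hy]
      | single q v => simp [hα, hψ]
    · change α (coeffMap Γ _ 0 z default) = α (z default)
      rw [coeffMap_apply, hαt]

end Action

/-! ### The sequence 0 → V[Q × ℤ] → V[Q × ℤ] → V[Q] → 0 -/

/-- Translation of the second factor. -/
def shiftMap (Q V : Type) [AddCommGroup V] [Module ℝ V] :
    (Q × Multiplicative ℤ →₀ V) →ₗ[ℝ] (Q × Multiplicative ℤ →₀ V) :=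
  Finsupp.lmapDomain V ℝ fun x => (x.1, x.2 * Multiplicative.ofAdd 1)

lemma shiftMap_single (x : Q × Multiplicative ℤ) (v : V) : shiftMap Q V (Finsupp.single x v) =
    Finsupp.single (x.1, x.2 * Multiplicative.ofAdd 1) v := by
  simp [shiftMap]

/-- An element of the kernel is constant along each copy of ℤ, so finite support forces it to
vanish. -/
lemma shiftMap_sub_injective : Function.Injective
    (shiftMap Q V - LinearMap.id : (Q × Multiplicative ℤ →₀ V) →ₗ[ℝ] _) := by
  classical
  rw [← LinearMap.ker_eq_bot, LinearMap.ker_eq_bot']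
  intro F hF
  have hinj : Function.Injective fun x : Q × Multiplicative ℤ =>
      (x.1, x.2 * Multiplicative.ofAdd (1 : ℤ)) := fun x y h => by
    simpa [Prod.ext_iff] using h
  have hinv : ∀ q (n : Multiplicative ℤ), F (q, n * Multiplicative.ofAdd 1) = F (q, n) := by
    intro q n
    have h1 : shiftMap Q V F = F := sub_eq_zero.1 hF
    have h2 : shiftMap Q V F (q, n * Multiplicative.ofAdd 1) = F (q, n) :=
      Finsupp.mapDomain_apply hinj F (q, n)
    rw [← h2, h1]
  ext ⟨q, n⟩
  by_contra hne
  have hall : ∀ m : ℕ, F (q, n * Multiplicative.ofAdd (m : ℤ)) = F (q, n) := by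
    intro m
    induction m with
    | zero => simp
    | succ m ih => rw [← ih, Nat.cast_succ, ofAdd_add, ← mul_assoc, hinv]
  refine Set.infinite_of_injective_forall_mem (f := fun m : ℕ =>
    (q, n * Multiplicative.ofAdd (m : ℤ))) (fun a b h => ?_) (fun m => ?_) F.support.finite_toSet
  · simpa [Prod.ext_iff] using h
  · rw [Finset.mem_coe, Finsupp.mem_support_iff, hall]
    exact hne

lemma single_sub_single_mem_range (q : Q) (n : Multiplicative ℤ) (v : V) :
    Finsupp.single (q, n) v - Finsupp.single (q, 1) v ∈
      LinearMap.range (shiftMap Q V - LinearMap.id) := by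
  have hstep : ∀ n : Multiplicative ℤ, Finsupp.single (q, n * Multiplicative.ofAdd 1) v -
      Finsupp.single (q, n) v ∈ LinearMap.range (shiftMap Q V - LinearMap.id) := fun n =>
    ⟨Finsupp.single (q, n) v, by simp [shiftMap_single]⟩
  obtain ⟨k, rfl⟩ := Multiplicative.ofAdd.surjective n
  induction k using Int.induction_on with
  | zero => simp
  | succ i ih =>
    have := add_mem (hstep (Multiplicative.ofAdd (i : ℤ))) ih
    rwa [sub_add_sub_cancel, ← ofAdd_add] at this
  | pred i ih =>
    have := sub_mem ih (hstep (Multiplicative.ofAdd (-(i : ℤ) - 1)))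
    rw [← ofAdd_add, sub_add_cancel] at this
    convert this using 1
    abel

lemma mapDomain_fst_eq_zero_iff (F : Q × Multiplicative ℤ →₀ V) :
    Finsupp.lmapDomain V ℝ Prod.fst F = 0 ↔
      F ∈ LinearMap.range (shiftMap Q V - LinearMap.id) := by
  -- Modulo the range of shift minus identity, all mass can be moved to the coordinate 1 of ℤ.
  have hred : ∀ F : Q × Multiplicative ℤ →₀ V, F - Finsupp.lmapDomain V ℝ (fun q => (q, 1))
      (Finsupp.lmapDomain V ℝ Prod.fst F) ∈ LinearMap.range (shiftMap Q V - LinearMap.id) := by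
    intro F
    induction F using Finsupp.induction_linear with
    | zero => simp
    | add F F' h h' =>
      have := add_mem h h'
      simp only [map_add]
      convert this using 1
      abel
    | single x v => simpa using single_sub_single_mem_range x.1 x.2 v
  constructor
  · intro h
    simpa [h] using hred F
  · rintro ⟨F, rfl⟩
    induction F using Finsupp.induction_linear with
    | zero => simp
    | add F F' h h' => rw [map_add, map_add, h, h', add_zero]
    | single x v =>
      simp only [LinearMap.sub_apply, map_sub, shiftMap_single, LinearMap.id_apply,
        Finsupp.lmapDomain_apply, Finsupp.mapDomain_single, sub_self]

/-- Induction on the rank d of the complement of Q in Γ. One factor ℤ of the complement is moved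
into Q, which is why Q varies, and the shift sequence then raises the degree by one. -/
lemma isTopDetected_indRep (ρ : Representation ℝ Γ V) (d : ℕ) : ∀ {Q : Type} [CommGroup Q]
    (r : Γ →* Q) (χ : Γ →* Multiplicative (Fin d → ℤ)), Function.Bijective (r.prod χ) →
    IsTopDetected ρ (indRep r ρ) Finsupp.mapRange.linearMap d := by
  induction d with
  | zero =>
    intro Q _ r χ h
    have hr : Function.Bijective r := by
      refine ⟨fun a b hab => h.1 (Prod.ext hab (Subsingleton.elim _ _)), fun q => ?_⟩
      obtain ⟨a, ha⟩ := h.2 (q, 1)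
      exact ⟨a, congrArg Prod.fst ha⟩
    exact isTopDetected_indRep_equiv (MulEquiv.ofBijective r hr) ρ
  | succ d ih =>
    intro Q _ r χ h
    let χ₀ : Γ →* Multiplicative ℤ :=
      (AddMonoidHom.toMultiplicative (Pi.evalAddMonoidHom (fun _ : Fin (d + 1) => ℤ) 0)).comp χ
    have hbij : Function.Bijective ((r.prod χ₀).prod ((intPowSnd d).comp χ)) := by
      constructor
      · intro a b hab
        have h1 : r a = r b := congrArg (fun x => x.1.1) hab
        have h2 : Multiplicative.toAdd (χ a) 0 = Multiplicative.toAdd (χ b) 0 :=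
          congrArg (fun x => Multiplicative.toAdd x.1.2) hab
        have h3 : Fin.tail (Multiplicative.toAdd (χ a)) = Fin.tail (Multiplicative.toAdd (χ b)) :=
          congrArg (fun x => Multiplicative.toAdd x.2) hab
        refine h.1 (Prod.ext h1 (Multiplicative.toAdd.injective ?_))
        change Multiplicative.toAdd (χ a) = Multiplicative.toAdd (χ b)
        rw [← Fin.cons_self_tail (Multiplicative.toAdd (χ a)), h2, h3, Fin.cons_self_tail]
      · rintro ⟨⟨q, n⟩, x⟩
        obtain ⟨a, ha⟩ := h.2 (q, Multiplicative.ofAdd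
          (Fin.cons (Multiplicative.toAdd n) (Multiplicative.toAdd x) : Fin (d + 1) → ℤ))
        have h1 : r a = q := congrArg Prod.fst ha
        have h2 : χ a = Multiplicative.ofAdd
          (Fin.cons (Multiplicative.toAdd n) (Multiplicative.toAdd x) : Fin (d + 1) → ℤ) :=
          congrArg Prod.snd ha
        refine ⟨a, Prod.ext (Prod.ext h1 ?_) ?_⟩
        · change Multiplicative.ofAdd (Multiplicative.toAdd (χ a) 0) = n
          rw [h2]
          rfl
        · change Multiplicative.ofAdd (Fin.tail (Multiplicative.toAdd (χ a))) = x
          rw [h2]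
          rfl
    refine (ih (r.prod χ₀) _ hbij).shift (shiftMap Q V - LinearMap.id)
      (Finsupp.lmapDomain V ℝ Prod.fst) (Finsupp.lmapDomain V ℝ fun q => (q, 1))
      shiftMap_sub_injective mapDomain_fst_eq_zero_iff (fun x => ?_) (fun γ x => ?_)
      (fun γ x => ?_) (fun ψ hψ γ x => ?_) (fun ψ x => ?_) (fun ψ x => ?_)
    all_goals
      induction x using Finsupp.induction_linear with
      | zero => simp
      | add x y hx hy => simp only [map_add, hx, hy]
      | single q v =>
        try simp only [LinearMap.sub_apply, LinearMap.id_apply, map_sub]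
        simp [indRep_single, shiftMap_single, mul_assoc, *]

/-- The homology of `ℤ^l` vanishes above degree `l`, and in degree `l` it embeds into the
invariants of the coefficients. -/
theorem exists_invariant_detection {l : ℕ}
    (ρ : Representation ℝ (Multiplicative (Fin l → ℤ)) V) :
    (∀ k, l < k → ∀ z ∈ barCycles ρ k, z ∈ LinearMap.range (barD ρ k)) ∧
    ∃ θ : ((Fin l → Multiplicative (Fin l → ℤ)) →₀ V) →ₗ[ℝ] V,
      (∀ z ∈ barCycles ρ l, θ z = 0 → z ∈ LinearMap.range (barD ρ l)) ∧
      (∀ b, θ (barD ρ l b) = 0) ∧ ∀ z ∈ barCycles ρ l, ∀ t, ρ t (θ z) = θ z := by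
  let r : Multiplicative (Fin l → ℤ) →* Unit := 1
  obtain ⟨hvan, θ, ha, hb, hc, hd⟩ := isTopDetected_indRep ρ l r (MonoidHom.id _)
    ⟨fun a b h => congrArg Prod.snd h, fun x => ⟨x.2, rfl⟩⟩
  let L : V →ₗ[ℝ] (Unit →₀ V) := Finsupp.lsingle ()
  let L' : (Unit →₀ V) →ₗ[ℝ] V := Finsupp.lapply ()
  have hL : ∀ γ v, L (ρ γ v) = indRep r ρ γ (L v) := fun γ v => (indRep_single r ρ γ () v).symm
  have hL' : ∀ γ x, L' (indRep r ρ γ x) = ρ γ (L' x) := by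
    intro γ x
    obtain ⟨v, rfl⟩ : ∃ v, x = L v := ⟨x (), by ext; simp [L]⟩
    rw [← hL]
    simp [L, L']
  have hLL : ∀ (n : ℕ) z, coeffMap (Multiplicative (Fin l → ℤ)) L' n (coeffMap _ L n z) = z :=
    fun n z => Finsupp.ext fun g => by
      rw [coeffMap_apply, coeffMap_apply]
      simp [L, L']
  have hpull : ∀ (n : ℕ) z, coeffMap _ L n z ∈ LinearMap.range (barD (indRep r ρ) n) →
      z ∈ LinearMap.range (barD ρ n) := by
    rintro n z ⟨b, hb⟩
    refine ⟨coeffMap _ L' (n + 1) b, ?_⟩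
    rw [barD_coeffMap hL', hb, hLL]
  refine ⟨fun k hk z hz => hpull k z (hvan k hk _ (coeffMap_mem_barCycles hL hz)),
    θ ∘ₗ coeffMap _ L l, fun z hz h0 => hpull l z (ha _ (coeffMap_mem_barCycles hL hz) h0),
    fun b => ?_, fun z hz t => ?_⟩
  · rw [LinearMap.comp_apply, ← barD_coeffMap hL, hb]
  · have hz' := coeffMap_mem_barCycles hL hz
    have hcomm : ∀ γ v, ρ t (ρ γ v) = ρ γ (ρ t v) := fun γ v => by
      rw [← Module.End.mul_apply, ← map_mul, mul_comm, map_mul, Module.End.mul_apply]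
    -- For the trivial quotient, `ρ t` on coefficients is the action of t itself, and θ ignores that
    -- action on cycles. Naturality of θ under `ρ t`, equivariant by commutativity, makes θ z
    -- invariant.
    rw [LinearMap.comp_apply, ← hc (ρ t) hcomm _ hz', ← hd t _ hz']
    congr 1
    ext1 g
    simp only [coeffMap_apply]
    rw [← hL]
    simp [L]

end Induced

end TopDegree

/-! ### Uniformly finite homology of semidirect products and of free abelian groups -/

section Main

lemma countable_of_fg (G : Type*) [Group G] [Group.FG G] : Countable G := by
  obtain ⟨S, hS, φ, hφ⟩ := Group.fg_iff_exists_freeGroup_hom_surjective.1 ‹Group.FG G›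
  have := hS.countable.to_subtype
  exact hφ.countable

theorem not_finiteDimensional_ufGroupHomology {G A H : Type*} [Group G] [Infinite G] [Countable G]
    [Group A] [Group H] (hH : HasRightMean H) (j : G →* H) (ι : A →* H) (π : H →* A)
    (hπ : ∀ a, π (ι a) = a) (p : H → G) (hp : ∀ x h, p (j x * h) = x * p h)
    (hpι : ∀ h a, p (h * ι a) = p h) {k : ℕ} (hA : HasPairing A k) (S : Finset H)
    (hS : Subgroup.closure (S : Set H) = ⊤) : ¬ FiniteDimensional ℝ (ufGroupHomology S hS k) := by
  obtain ⟨f, m, hf, hm, hmf⟩ := exists_separated_means hH j ι p hp hpι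
  let := wordMetricSpace (S : Set H) hS
  exact not_finiteDimensional_ufHomology (isInvariantProper_wordMetric S hS) ι π hπ f m hf hm hmf hA

theorem not_finiteDimensional_semidirectProduct {G A : Type*} [Group G] [Infinite G] [Countable G]
    [Group A] (hG : HasRightMean G) (hA : HasRightMean A) (φ : A →* MulAut G) {k : ℕ}
    (hk : HasPairing A k) (S : Finset (G ⋊[φ] A))
    (hS : Subgroup.closure (S : Set (G ⋊[φ] A)) = ⊤) :
    ¬ FiniteDimensional ℝ (ufGroupHomology S hS k) := by
  refine not_finiteDimensional_ufGroupHomology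
    (HasRightMean.of_extension SemidirectProduct.inl SemidirectProduct.inr
      (fun y a => ⟨φ a y, ?_⟩) (fun h => ⟨h.left, h.right, ?_⟩) hG hA)
    SemidirectProduct.inl SemidirectProduct.inr SemidirectProduct.rightHom (fun a => ?_)
    SemidirectProduct.left (fun x h => ?_) (fun h a => ?_) hk S hS
  · simp [SemidirectProduct.ext_iff]
  · exact (SemidirectProduct.inl_left_mul_inr_right h).symm
  · simp
  · simp
  · simp

/-- In ℤ × ℤ^(l-1) the first factor plays the role of G, and k ≤ l − 1 leaves room for a k-torus in
the second. -/
theorem not_finiteDimensional_intPow {l k : ℕ} (hk : k < l)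
    (S : Finset (Multiplicative (Fin l → ℤ)))
    (hS : Subgroup.closure (S : Set (Multiplicative (Fin l → ℤ))) = ⊤) :
    ¬ FiniteDimensional ℝ (ufGroupHomology S hS k) := by
  obtain ⟨n, rfl⟩ : ∃ n, l = n + 1 := ⟨l - 1, by omega⟩
  refine not_finiteDimensional_ufGroupHomology (hasRightMean_intPow (n + 1)) (intPowInl n)
    (intPowInr n) (intPowSnd n) (fun a => ?_)
    (fun h => Multiplicative.ofAdd (Multiplicative.toAdd h 0)) (fun x h => ?_) (fun h a => ?_)
    (hasPairing_intPow (Nat.lt_succ_iff.1 hk)) S hS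
  · rfl
  · rfl
  · refine Multiplicative.toAdd.injective ?_
    change Multiplicative.toAdd h 0 + 0 = Multiplicative.toAdd h 0
    rw [add_zero]

theorem subsingleton_ufHomology_intPow {l k : ℕ} (hk : l < k)
    [PseudoMetricSpace (Multiplicative (Fin l → ℤ))]
    (hH : IsInvariantProper (Multiplicative (Fin l → ℤ))) :
    Subsingleton (ufHomology (Multiplicative (Fin l → ℤ)) k) := by
  obtain ⟨cl, hcl, hcl0⟩ := exists_ufHomology_class hH k
  refine subsingleton_of_forall_eq 0 fun y => ?_
  obtain ⟨z, rfl⟩ := hcl y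
  exact (hcl0 z).2 ((exists_invariant_detection _).1 k hk z.1 z.2)

theorem nonempty_equiv_ufHomology_intPow (l : ℕ)
    [PseudoMetricSpace (Multiplicative (Fin l → ℤ))]
    (hH : IsInvariantProper (Multiplicative (Fin l → ℤ))) :
    Nonempty (ufHomology (Multiplicative (Fin l → ℤ)) l ≃ₗ[ℝ] ℝ) := by
  let Γ := Multiplicative (Fin l → ℤ)
  obtain ⟨cl, hcl, hcl0⟩ := exists_ufHomology_class hH l
  obtain ⟨-, θ, ha, hb, hinv⟩ := exists_invariant_detection (rightTranslation Γ)
  -- θ z is invariant under right translation, hence constant, so its value at 1 determines it.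
  let ev : barCycles (rightTranslation Γ) l →ₗ[ℝ] ℝ :=
    LinearMap.proj (1 : Γ) ∘ₗ (boundedFun Γ).subtype ∘ₗ θ ∘ₗ Submodule.subtype _
  have hker : LinearMap.ker cl = LinearMap.ker ev := by
    ext z
    rw [LinearMap.mem_ker, LinearMap.mem_ker, hcl0]
    constructor
    · rintro ⟨b, hbz⟩
      change (θ z.1).1 1 = 0
      rw [← hbz, hb]
      rfl
    · intro hz
      refine ha z.1 z.2 (Subtype.ext (funext fun t => ?_))
      have h1 := congrFun (congrArg Subtype.val (hinv z.1 z.2 t)) 1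
      rw [rightTranslation_apply, one_mul] at h1
      exact h1.trans hz
  -- A functional to ℝ is onto once it is nonzero. It is nonzero on the torus cycle with constant
  -- coefficient 1, whose class is detected by a mean and a cocycle.
  have hev : Function.Surjective ev := by
    obtain ⟨a, haz, u, hu, hua⟩ := hasPairing_intPow (le_refl l)
    obtain ⟨m, hm1, hm2⟩ := hasRightMean_intPow l
    let e : boundedFun Γ := ⟨fun _ => 1, 1, by simp⟩
    have hz : barMap (MonoidHom.id Γ) (LinearMap.toSpanSingleton ℝ _ e) l a ∈
        barCycles (rightTranslation Γ) l :=
      barMap_mem_barCycles _ _ (σ := Representation.trivial ℝ Γ ℝ) (fun b x => by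
        ext
        simp [e]) haz
    have hne : ev ⟨_, hz⟩ ≠ 0 := by
      intro h0
      have h1 : cl ⟨_, hz⟩ = 0 := by
        rw [← LinearMap.mem_ker, hker]
        exact h0
      obtain ⟨b, hb⟩ := (hcl0 _).1 h1
      have h2 := averaging_barD m hm2 (MonoidHom.id Γ) hu b
      rw [hb, barMap_comp_averaging _ _ _ _ (fun _ => rfl), hm1.const_one e fun _ => rfl,
        one_smul] at h2
      exact hua h2
    exact LinearMap.surjective fun h => hne (by rw [h]; rfl)
  exact ⟨(cl.quotKerEquivOfSurjective hcl).symm ≪≫ₗ Submodule.quotEquivOfEq _ _ hker ≪≫ₗ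
    ev.quotKerEquivOfSurjective hev⟩

theorem mainTheorem8 :
    (∀ (G : Type*) [Group G] [Group.FG G] [Infinite G], IsAmenableGroup G →
      (∀ (l : ℕ) (φ : Multiplicative (Fin l → ℤ) →* MulAut G)
          (S : Finset (G ⋊[φ] Multiplicative (Fin l → ℤ)))
          (hS : Subgroup.closure (S : Set (G ⋊[φ] Multiplicative (Fin l → ℤ))) = ⊤)
          (k : ℕ), k ≤ l → ¬ FiniteDimensional ℝ (ufGroupHomology S hS k)) ∧
      (∀ (A : Type*) [Group A] [Group.FG A], IsAmenableGroup A →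
        ∀ (φ : A →* MulAut G) (S : Finset (G ⋊[φ] A))
          (hS : Subgroup.closure (S : Set (G ⋊[φ] A)) = ⊤)
          (k : ℕ), Nontrivial (realGroupHomology A k) →
            ¬ FiniteDimensional ℝ (ufGroupHomology S hS k))) ∧
    (∀ (l : ℕ) (S : Finset (Multiplicative (Fin l → ℤ)))
        (hS : Subgroup.closure (S : Set (Multiplicative (Fin l → ℤ))) = ⊤) (k : ℕ),
      (k < l → ¬ FiniteDimensional ℝ (ufGroupHomology S hS k)) ∧
      (k = l → Nonempty (ufGroupHomology S hS k ≃ₗ[ℝ] ℝ)) ∧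
      (l < k → Subsingleton (ufGroupHomology S hS k))) := by
  refine ⟨fun G _ _ _ hG => ?_, fun l S hS k =>
    ⟨fun hk => not_finiteDimensional_intPow hk S hS, ?_, fun hk => ?_⟩⟩
  · have : Countable G := countable_of_fg G
    exact ⟨fun l φ S hS k hk => not_finiteDimensional_semidirectProduct hG.hasRightMean
        (hasRightMean_intPow l) φ (hasPairing_intPow hk) S hS,
      fun A _ _ hA φ S hS k hk => not_finiteDimensional_semidirectProduct hG.hasRightMean
        hA.hasRightMean φ (HasPairing.of_nontrivial hk) S hS⟩
  · rintro rfl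
    exact @nonempty_equiv_ufHomology_intPow k (wordMetricSpace _ hS).toPseudoMetricSpace
      (isInvariantProper_wordMetric S hS)
  · exact @subsingleton_ufHomology_intPow l k hk (wordMetricSpace _ hS).toPseudoMetricSpace
      (isInvariantProper_wordMetric S hS)

end Main

end
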